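/- **Notation.** Operators act on a finite-dimensional two-party space $\mathcal H_A\otimes\mathcal H_B$; $E^{\Gamma}$ denotes the partial transpose of $E$ with respect to the computational basis of $\mathcal H_B$, and $\mathrm{Tr}|E|$ the trace norm, $|E|=\sqrt{E^\dagger E}$. For an ensemble $\mathcal E=\{\eta_0,\rho_0;\eta_1,\rho_1\}$ of two states with prior probabilities put $\Lambda_{\mathcal E}=\eta_0\rho_0-\eta_1\rho_1$, and let $p_{\mathsf G}(\mathcal E)$, $p_{\mathsf{PPT}}(\mathcal E)$, $p_{\mathsf L}(\mathcal E)$ be the supremum of $\sum_{i\in\{0,1\}}\eta_i\mathrm{Tr}(\rho_iM_i)$ over, respectively, all measurements $\{M_0,M_1\}$ ($M_i\succeq0$, $M_0+M_1=\mathbb 1$), all measurements with $M_0^\Gamma,M_1^\Gamma\succeq 0$, and all measurements implementable by (finitely many rounds of) local operations and classical communication (LOCC). For an integer $L\ge1$ and $\vec b\in\{0,1\}^L$ let $\eta_{\vec b}=\prod_l\eta_{b_l}$, $\rho_{\vec b}=\bigotimes_l\rho_{b_l}$ (a state of $\mathcal H_A^{\otimes L}\otimes\mathcal H_B^{\otimes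 L}$), and let $\mathcal E^{(L)}=\{\eta^{(L)}_0,\rho^{(L)}_0;\eta^{(L)}_1,\rho^{(L)}_1\}$ with $$\eta_i^{(L)}=\sum_{b_1\oplus\cdots\oplus b_L=i}\eta_{\vec b},\qquad \rho_i^{(L)}=\frac1{\eta_i^{(L)}}\sum_{b_1\oplus\cdots\oplus b_L=i}\eta_{\vec b}\,\rho_{\vec b}.$$ **The ensemble.** For $0\le\theta\le\pi/3$ let $|{+_\theta}\rangle=\cos\theta|0\rangle+\sin\theta|1\rangle$, $|{-_\theta}\rangle=\sin\theta|0\rangle-\cos\theta|1\rangle$, and let $\mathcal E$ be the two-qubit ensemble with $\eta_0=\eta_1=\frac12$ and $$\rho_0=\tfrac12|0\rangle\langle0|\otimes|{+_\theta}\rangle\langle{+_\theta}|+\tfrac12|{+_\theta}\rangle\langle{+_\theta}|\otimes|0\rangle\langle0|,\qquad \rho_1=\tfrac12|1\rangle\langle1|\otimes|1\rangle\langle1|+\tfrac12|{-_\theta}\rangle\langle{-_\theta}|\otimes|{-_\theta}\rangle\langle{-_\theta}|.$$ **The operator $H$.** Let $|\psi_0^+\rangle=\frac1{\sqrt2}(|00\rangle+|11\rangle)$,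 $|\psi_1^+\rangle=\frac1{\sqrt2}(|01\rangle-|10\rangle)$, $|\psi_0^-\rangle=\frac{\cos\theta}{\sqrt2}(|00\rangle-|11\rangle)+\frac{\sin\theta}{\sqrt2}(|01\rangle+|10\rangle)$, $|\psi_1^-\rangle=\frac{\sin\theta}{\sqrt2}(|00\rangle-|11\rangle)-\frac{\cos\theta}{\sqrt2}(|01\rangle+|10\rangle)$; with $n=\sqrt{1+\cos^2\theta}$ let $$|\phi^{\pm}\rangle=\tfrac{\cos\theta}{n}|\psi_0^\pm\rangle\pm\tfrac1n|\psi_0^\mp\rangle,\qquad |\chi^{\pm}\rangle=\tfrac{\cos\theta}{n}|\psi_0^\mp\rangle\mp\tfrac1n|\psi_0^\pm\rangle,$$ and let $|\Psi_0^\pm\rangle=\frac1{\sqrt2}(|\psi_0^+\rangle|\psi_0^\pm\rangle\mp|\psi_0^-\rangle|\psi_0^\mp\rangle)$, $|\Psi_1^\pm\rangle=\frac1{\sqrt2}(|\psi_0^+\rangle|\psi_0^\pm\rangle\pm|\psi_0^-\rangle|\psi_0^\mp\rangle)$, $|\Psi_4^\pm\rangle=|\phi^\pm\rangle|\psi_1^+\rangle$,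 $|\Psi_5^\pm\rangle=|\chi^\pm\rangle|\psi_1^-\rangle$, $|\Psi_6^\pm\rangle=|\psi_1^+\rangle|\phi^\pm\rangle$, $|\Psi_7^\pm\rangle=|\psi_1^-\rangle|\chi^\pm\rangle$. With $D_i=|\Psi_i^+\rangle\langle\Psi_i^+|-|\Psi_i^-\rangle\langle\Psi_i^-|$ put $$H=\tfrac{\sin^4\theta-2\cos^2\theta}{16}D_0-\tfrac{\cos\theta\sin^2\theta}{8}\big(|\Psi_0^+\rangle\langle\Psi_0^-|+|\Psi_0^-\rangle\langle\Psi_0^+|\big)+\tfrac{1+\cos^4\theta}{16}D_1+\tfrac{1-\cos^4\theta}{32}\sum_{i=4}^7D_i .$$ Finally let $$f_0(\theta)=\tfrac{3-\cos^4\theta+\sqrt{4\cos^4\theta+\sin^8\theta}}{8},\qquad f_1(\theta)=\tfrac{1+\sin^2\theta+\cos\theta\sqrt{\cos^2\theta+\sin^4\theta}}{4}.$$ **Claim.** For every $\theta$ with $0\le\theta\le\pi/3$: 1. $\rho_0,\rho_1$ are separable states, they are orthogonal ($\rho_0\rho_1=0$), and $\Lambda_{\mathcal E}^{\Gamma}=\Lambda_{\mathcal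 E}$. 2. $H$ is Hermitian, $H+H^\Gamma=\Lambda_{\mathcal E}^{\otimes2}$, $\mathrm{Tr}|H|=f_0(\theta)$ and $\mathrm{Tr}|H^\Gamma|=f_1(\theta)$. 3. For every integer $L\ge1$, $p_{\mathsf G}(\mathcal E^{(L)})=1$ and $\frac12\le p_{\mathsf L}(\mathcal E^{(L)})\le p_{\mathsf{PPT}}(\mathcal E^{(L)})$. 4. If $4f_0(\theta)f_1(\theta)<1$, then for every integer $L\ge1$ $$p_{\mathsf{PPT}}(\mathcal E^{(L)})\le\tfrac12+\tfrac12\big[4f_0(\theta)f_1(\theta)\big]^{\frac{L-1}4},$$ so that $p_{\mathsf{PPT}}(\mathcal E^{(L)})\to\frac12$ and $p_{\mathsf L}(\mathcal E^{(L)})\to\frac12$ as $L\to\infty$, and $\mathcal E$ yields a scheme hiding one classical bit. Explicitly, let the hider draw $\vec b$ with probability $\eta_{\vec b}$, distribute $\rho_{\vec b}$ to the two players, and broadcast $z=x\oplus b_1\oplus\cdots\oplus b_L$ in order to hide $x\in\{0,1\}$. Then for every $L\ge1$ suitable global measurements (depending on $z$) recover each value of $x$ with probability $1$, while for every $\varepsilon>0$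 and all sufficiently large $L$ every choice of LOCC measurements (depending on $z$) guesses a uniformly random $x$ correctly with probability at most $\frac12+\varepsilon$. Moreover, the condition $4f_0f_1<1$ holds at $\theta=\pi/6$ and $\theta=\pi/4$: $$4f_0(\tfrac\pi6)f_1(\tfrac\pi6)=\tfrac{(39+\sqrt{577})(10+\sqrt{39})}{1024}\approx0.9998,\qquad 4f_0(\tfrac\pi4)f_1(\tfrac\pi4)=\tfrac{(11+\sqrt{17})(6+\sqrt6)}{128}\approx0.9983,$$ both approximations being correct to within $5\cdot10^{-5}$. -/

import Mathlib

open scoped Kronecker ComplexOrder MatrixOrder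
open Matrix Filter Topology

noncomputable section

namespace DataHiding

/-! Operators on a two-party space are complex matrices indexed by `α × β`, where `α` labels
Alice's computational basis and `β` labels Bob's. Bits are elements of `ZMod 2`. -/

/-- Partial transposition, on Bob's side. -/
def partialTranspose {α β : Type} (M : Matrix (α × β) (α × β) ℂ) : Matrix (α × β) (α × β) ℂ :=
  Matrix.of fun i j => M (i.1, j.2) (j.1, i.2)

/-- The trace norm `Tr |A|`, where `|A|` is the positive square root of `Aᴴ * A`. -/
def traceNorm {n : Type} [Fintype n] [DecidableEq n] (A : Matrix n n ℂ) : ℝ :=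
  (CFC.abs A).trace.re

/-- Density operators. -/
def IsState {n : Type} [Fintype n] (ρ : Matrix n n ℂ) : Prop :=
  ρ.PosSemidef ∧ ρ.trace = 1

/-- Separable states: finite convex combinations of product states. -/
def IsSeparableState {α β : Type} [Fintype α] [Fintype β] (ρ : Matrix (α × β) (α × β) ℂ) : Prop :=
  ∃ (n : ℕ) (p : Fin n → ℝ) (σ : Fin n → Matrix α α ℂ) (τ : Fin n → Matrix β β ℂ),
    (∀ i, 0 ≤ p i) ∧ ∑ i, p i = 1 ∧ (∀ i, IsState (σ i)) ∧ (∀ i, IsState (τ i)) ∧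
      ρ = ∑ i, p i • (σ i ⊗ₖ τ i)

/-- A measurement with outcomes in `κ`. -/
def IsMeasurement {κ n : Type} [Fintype κ] [DecidableEq n] (M : κ → Matrix n n ℂ) : Prop :=
  (∀ k, (M k).PosSemidef) ∧ ∑ k, M k = 1

/-- A measurement all of whose elements have positive semidefinite partial transpose. -/
def IsPPTMeasurement {κ α β : Type} [Fintype κ] [DecidableEq α] [DecidableEq β]
    (M : κ → Matrix (α × β) (α × β) ℂ) : Prop :=
  IsMeasurement M ∧ ∀ k, (partialTranspose (M k)).PosSemidef

/-- The measurements with outcomes in `κ` that are implemented by a protocol of finitely many rounds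
of local operations and classical communication. A protocol either stops and announces an outcome,
or one of the players applies to their own system a quantum instrument with finitely many outcomes
`i`, given by Kraus operators `K i` whose output dimension `d i` is arbitrary, broadcasts `i`, and
the players continue with a protocol that may depend on `i`. (Instruments with several Kraus
operators per outcome, shared randomness and withheld information are covered, since
the rest of the protocol is free to ignore a part of `i`.) -/
inductive IsLOCC {κ : Type} [DecidableEq κ] :
    ∀ (α β : Type) [Fintype α] [DecidableEq α] [Fintype β] [DecidableEq β],
      (κ → Matrix (α × β) (α × β) ℂ) → Prop
  | announce (α β : Type) [Fintype α] [DecidableEq α] [Fintype β] [DecidableEq β] (k : κ) :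
      IsLOCC α β (fun j => if j = k then 1 else 0)
  | alice (α β : Type) [Fintype α] [DecidableEq α] [Fintype β] [DecidableEq β]
      (n : ℕ) (d : Fin n → ℕ) (K : ∀ i, Matrix (Fin (d i)) α ℂ)
      (hK : ∑ i, (K i)ᴴ * K i = 1)
      (N : ∀ i, κ → Matrix (Fin (d i) × β) (Fin (d i) × β) ℂ)
      (hN : ∀ i, IsLOCC (Fin (d i)) β (N i)) :
      IsLOCC α β (fun j => ∑ i,
        (K i ⊗ₖ (1 : Matrix β β ℂ))ᴴ * N i j * (K i ⊗ₖ (1 : Matrix β β ℂ)))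
  | bob (α β : Type) [Fintype α] [DecidableEq α] [Fintype β] [DecidableEq β]
      (n : ℕ) (d : Fin n → ℕ) (K : ∀ i, Matrix (Fin (d i)) β ℂ)
      (hK : ∑ i, (K i)ᴴ * K i = 1)
      (N : ∀ i, κ → Matrix (α × Fin (d i)) (α × Fin (d i)) ℂ)
      (hN : ∀ i, IsLOCC α (Fin (d i)) (N i)) :
      IsLOCC α β (fun j => ∑ i,
        ((1 : Matrix α α ℂ) ⊗ₖ K i)ᴴ * N i j * ((1 : Matrix α α ℂ) ⊗ₖ K i))

/-- Average probability of guessing correctly the state prepared from the two-state ensemble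
`{η 0, ρ 0; η 1, ρ 1}` by means of the measurement `M`. -/
def success {n : Type} [Fintype n] (η : ZMod 2 → ℝ) (ρ M : ZMod 2 → Matrix n n ℂ) : ℝ :=
  ∑ i, η i * (ρ i * M i).trace.re

/-- Optimal guessing probability over all measurements. -/
def pG {n : Type} [Fintype n] [DecidableEq n] (η : ZMod 2 → ℝ) (ρ : ZMod 2 → Matrix n n ℂ) : ℝ :=
  sSup {p | ∃ M : ZMod 2 → Matrix n n ℂ, IsMeasurement M ∧ p = success η ρ M}

section TwoParty

variable {α β : Type} [Fintype α] [DecidableEq α] [Fintype β] [DecidableEq β]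

/-- Optimal guessing probability over all PPT measurements. -/
def pPPT (η : ZMod 2 → ℝ) (ρ : ZMod 2 → Matrix (α × β) (α × β) ℂ) : ℝ :=
  sSup {p | ∃ M : ZMod 2 → Matrix (α × β) (α × β) ℂ, IsPPTMeasurement M ∧ p = success η ρ M}

/-- Optimal guessing probability over all LOCC measurements. -/
def pL (η : ZMod 2 → ℝ) (ρ : ZMod 2 → Matrix (α × β) (α × β) ℂ) : ℝ :=
  sSup {p | ∃ M : ZMod 2 → Matrix (α × β) (α × β) ℂ, IsLOCC α β M ∧ p = success η ρ M}

end TwoParty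

section Multifold

variable {α β : Type}

/-- The operator `η₀ρ₀ - η₁ρ₁`. -/
def lam {n : Type} (η : ZMod 2 → ℝ) (ρ : ZMod 2 → Matrix n n ℂ) : Matrix n n ℂ :=
  η 0 • ρ 0 - η 1 • ρ 1

/-- The tensor product of `L` two-party operators, with the `L` systems of Alice grouped together
and the `L` systems of Bob grouped together. -/
def tensor {L : ℕ} (X : Fin L → Matrix (α × β) (α × β) ℂ) :
    Matrix ((Fin L → α) × (Fin L → β)) ((Fin L → α) × (Fin L → β)) ℂ :=
  Matrix.of fun i j => ∏ l, X l (i.1 l, i.2 l) (j.1 l, j.2 l)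

/-- The probability of the string `b` in the `L`-fold ensemble. -/
def probStr (η : ZMod 2 → ℝ) {L : ℕ} (b : Fin L → ZMod 2) : ℝ := ∏ l, η (b l)

/-- The state indexed by the string `b` in the `L`-fold ensemble. -/
def stateStr (ρ : ZMod 2 → Matrix (α × β) (α × β) ℂ) {L : ℕ} (b : Fin L → ZMod 2) :
    Matrix ((Fin L → α) × (Fin L → β)) ((Fin L → α) × (Fin L → β)) ℂ :=
  tensor fun l => ρ (b l)

/-- The probability that the parity of the string drawn from the `L`-fold ensemble is `i`. -/
def probPar (η : ZMod 2 → ℝ) (L : ℕ) (i : ZMod 2) : ℝ :=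
  ∑ b : Fin L → ZMod 2 with ∑ l, b l = i, probStr η b

/-- The average state of the `L`-fold ensemble, given that the parity of the string is `i`. -/
def statePar (η : ZMod 2 → ℝ) (ρ : ZMod 2 → Matrix (α × β) (α × β) ℂ) (L : ℕ) (i : ZMod 2) :
    Matrix ((Fin L → α) × (Fin L → β)) ((Fin L → α) × (Fin L → β)) ℂ :=
  (1 / probPar η L i) • ∑ b : Fin L → ZMod 2 with ∑ l, b l = i, probStr η b • stateStr ρ b

/-- The hiding protocol: the hider draws a string `b` from the `L`-fold ensemble, distributes the
state of `b` to Alice and Bob and broadcasts `z = x + ∑ l, b l` in order to conceal the bit `x`;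
the players then apply the measurement `M z` and take its outcome as their guess of `x`.
This is the probability that the guess is correct. -/
def recoverProb [Fintype α] [Fintype β] (η : ZMod 2 → ℝ)
    (ρ : ZMod 2 → Matrix (α × β) (α × β) ℂ) (L : ℕ)
    (M : ZMod 2 → ZMod 2 →
      Matrix ((Fin L → α) × (Fin L → β)) ((Fin L → α) × (Fin L → β)) ℂ) (x : ZMod 2) : ℝ :=
  ∑ b : Fin L → ZMod 2, probStr η b * (stateStr ρ b * M (x + ∑ l, b l) x).trace.re

/-- The protocol hides one classical bit: for every number `L ≥ 1` of repetitions some global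
measurements recover each value of the bit with certainty, while the average probability of
recovering a uniformly random bit by LOCC measurements is arbitrarily close to that of random
guessing as soon as `L` is large enough. -/
def HidesOneBit [Fintype α] [DecidableEq α] [Fintype β] [DecidableEq β] (η : ZMod 2 → ℝ)
    (ρ : ZMod 2 → Matrix (α × β) (α × β) ℂ) : Prop :=
  (∀ L : ℕ, 1 ≤ L →
    ∃ M : ZMod 2 → ZMod 2 →
        Matrix ((Fin L → α) × (Fin L → β)) ((Fin L → α) × (Fin L → β)) ℂ,
      (∀ z, IsMeasurement (M z)) ∧ ∀ x, recoverProb η ρ L M x = 1) ∧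
  ∀ ε : ℝ, 0 < ε → ∃ L₀ : ℕ, ∀ L : ℕ, L₀ ≤ L →
    ∀ M : ZMod 2 → ZMod 2 →
        Matrix ((Fin L → α) × (Fin L → β)) ((Fin L → α) × (Fin L → β)) ℂ,
      (∀ z, IsLOCC (Fin L → α) (Fin L → β) (M z)) →
        (recoverProb η ρ L M 0 + recoverProb η ρ L M 1) / 2 ≤ 1 / 2 + ε

end Multifold

section Example

/-- The operator `|v⟩⟨w|`. -/
def ketBra {n : Type} (v w : n → ℂ) : Matrix n n ℂ := Matrix.vecMulVec v (star w)

def ket0 : Fin 2 → ℂ := ![1, 0]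

def ket1 : Fin 2 → ℂ := ![0, 1]

def ketPlus (θ : ℝ) : Fin 2 → ℂ := Real.cos θ • ket0 + Real.sin θ • ket1

def ketMinus (θ : ℝ) : Fin 2 → ℂ := Real.sin θ • ket0 - Real.cos θ • ket1

/-- The two states are prepared with equal probabilities. -/
def exProb : ZMod 2 → ℝ := fun _ => 1 / 2

def exState (θ : ℝ) (i : ZMod 2) : Matrix (Fin 2 × Fin 2) (Fin 2 × Fin 2) ℂ :=
  if i = 0 then
    (1 / 2 : ℝ) • (ketBra ket0 ket0 ⊗ₖ ketBra (ketPlus θ) (ketPlus θ)) +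
      (1 / 2 : ℝ) • (ketBra (ketPlus θ) (ketPlus θ) ⊗ₖ ketBra ket0 ket0)
  else
    (1 / 2 : ℝ) • (ketBra ket1 ket1 ⊗ₖ ketBra ket1 ket1) +
      (1 / 2 : ℝ) • (ketBra (ketMinus θ) (ketMinus θ) ⊗ₖ ketBra (ketMinus θ) (ketMinus θ))

/-- The two-qubit vector `|ij⟩`. -/
def ket2 (i j : Fin 2) : Fin 2 × Fin 2 → ℂ := Pi.single (i, j) 1

/-- Tensor product of two two-qubit vectors, with the qubits of Alice and those of Bob grouped. -/
def ketMul (u v : Fin 2 × Fin 2 → ℂ) : (Fin 2 → Fin 2) × (Fin 2 → Fin 2) → ℂ :=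
  fun i => u (i.1 0, i.2 0) * v (i.1 1, i.2 1)

/-- The signs `+` and `-` are encoded as `true` and `false`. -/
def sgn (s : Bool) : ℝ := if s then 1 else -1

/-- The vectors `ψ₀⁺, ψ₀⁻`. -/
def psi0 (θ : ℝ) (s : Bool) : Fin 2 × Fin 2 → ℂ :=
  if s then (1 / √2) • (ket2 0 0 + ket2 1 1)
  else (Real.cos θ / √2) • (ket2 0 0 - ket2 1 1) + (Real.sin θ / √2) • (ket2 0 1 + ket2 1 0)

/-- The vectors `ψ₁⁺, ψ₁⁻`. -/
def psi1 (θ : ℝ) (s : Bool) : Fin 2 × Fin 2 → ℂ :=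
  if s then (1 / √2) • (ket2 0 1 - ket2 1 0)
  else (Real.sin θ / √2) • (ket2 0 0 - ket2 1 1) - (Real.cos θ / √2) • (ket2 0 1 + ket2 1 0)

/-- `(cos θ / √(1 + cos² θ)) ψ₀ˢ + (s / √(1 + cos² θ)) ψ₀⁻ˢ`. -/
def phiA (θ : ℝ) (s : Bool) : Fin 2 × Fin 2 → ℂ :=
  (Real.cos θ / √(1 + Real.cos θ ^ 2)) • psi0 θ s +
    (sgn s / √(1 + Real.cos θ ^ 2)) • psi0 θ (!s)

/-- `(cos θ / √(1 + cos² θ)) ψ₀⁻ˢ - (s / √(1 + cos² θ)) ψ₀ˢ`. -/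
def phiB (θ : ℝ) (s : Bool) : Fin 2 × Fin 2 → ℂ :=
  (Real.cos θ / √(1 + Real.cos θ ^ 2)) • psi0 θ (!s) -
    (sgn s / √(1 + Real.cos θ ^ 2)) • psi0 θ s

/-- The vectors `Ψᵢ⁺, Ψᵢ⁻` for `i = 0, …, 7`. -/
def bigPsi (θ : ℝ) (i : Fin 8) (s : Bool) : (Fin 2 → Fin 2) × (Fin 2 → Fin 2) → ℂ :=
  ![(1 / √2) • (ketMul (psi0 θ true) (psi0 θ s) - sgn s • ketMul (psi0 θ false) (psi0 θ (!s))),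
    (1 / √2) • (ketMul (psi0 θ true) (psi0 θ s) + sgn s • ketMul (psi0 θ false) (psi0 θ (!s))),
    ketMul (psi1 θ true) (psi1 θ s),
    ketMul (psi1 θ false) (psi1 θ (!s)),
    ketMul (phiA θ s) (psi1 θ true),
    ketMul (phiB θ s) (psi1 θ false),
    ketMul (psi1 θ true) (phiA θ s),
    ketMul (psi1 θ false) (phiB θ s)] i

/-- `|Ψᵢ⁺⟩⟨Ψᵢ⁺| - |Ψᵢ⁻⟩⟨Ψᵢ⁻|`. -/
def diagPart (θ : ℝ) (i : Fin 8) :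
    Matrix ((Fin 2 → Fin 2) × (Fin 2 → Fin 2)) ((Fin 2 → Fin 2) × (Fin 2 → Fin 2)) ℂ :=
  ketBra (bigPsi θ i true) (bigPsi θ i true) - ketBra (bigPsi θ i false) (bigPsi θ i false)

/-- The explicit operator `H`. -/
def exH (θ : ℝ) :
    Matrix ((Fin 2 → Fin 2) × (Fin 2 → Fin 2)) ((Fin 2 → Fin 2) × (Fin 2 → Fin 2)) ℂ :=
  ((Real.sin θ ^ 4 - 2 * Real.cos θ ^ 2) / 16) • diagPart θ 0
    - (Real.cos θ * Real.sin θ ^ 2 / 8) •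
      (ketBra (bigPsi θ 0 true) (bigPsi θ 0 false) + ketBra (bigPsi θ 0 false) (bigPsi θ 0 true))
    + ((1 + Real.cos θ ^ 4) / 16) • diagPart θ 1
    + ((1 - Real.cos θ ^ 4) / 32) •
      (diagPart θ 4 + diagPart θ 5 + diagPart θ 6 + diagPart θ 7)

def f0 (θ : ℝ) : ℝ :=
  (3 - Real.cos θ ^ 4 + √(4 * Real.cos θ ^ 4 + Real.sin θ ^ 8)) / 8

def f1 (θ : ℝ) : ℝ :=
  (1 + Real.sin θ ^ 2 + Real.cos θ * √(Real.cos θ ^ 2 + Real.sin θ ^ 4)) / 4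

end Example

end DataHiding

end

open DataHiding

/-!
Let `Λ = η₀ρ₀ - η₁ρ₁`. A measurement `{M 0, M 1}` guesses the parity of a string drawn from the
`L`-fold ensemble with probability `1/2 + Re Tr (Λ^{⊗L} Δ) / 2`, where `Δ = M 0 - M 1`
(`success_eq`). So everything depends on how large `Tr (Λ^{⊗L} Δ)` can be.

*Global measurements.* There is an observable `T` with `T² = 1` and `Λ T = |Λ|`, which has trace
`1` because `ρ₀` and `ρ₁` are orthogonal. Hence `Δ = T^{⊗L}` comes from a measurement and attains
`Tr (Λ T) ^ L = 1` (`exists_perfect_measurement`).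

*PPT measurements.* Both `Δ` and its partial transpose `Δ^Γ` are contractions, and
`Tr (X Δ) = Tr (X^Γ Δ^Γ)`, so that `Tr (X Δ)` is at most the smaller of `Tr |X|` and `Tr |X^Γ|`,
and therefore at most their geometric mean. Writing `Λ ⊗ Λ = H + H^Γ` and multiplying out
`Λ^{⊗(r + 2m)}`, with `r ≤ 1`, gives `2 ^ m` terms, each a tensor product of factors `H` and `H^Γ`
(and one factor `Λ = Λ^Γ` of trace norm one if `r = 1`). Partial transposition exchanges `H` and
`H^Γ`, so for every term the two trace norms have the product `(Tr |H| * Tr |H^Γ|) ^ m`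
(`splitBound_tensor_lam`). In total `Tr (Λ^{⊗L} Δ) ≤ (4 Tr |H| Tr |H^Γ|) ^ (m / 2)`, which is
`success_le_of_ppt`. LOCC measurements are PPT because partial transposition turns a Kraus operator
of Bob into its complex conjugate (`isLOCC_isPPTMeasurement`), and guessing the hidden bit from the
broadcast amounts to guessing the parity (`recoverProb_add_recoverProb`).

*The example.* In the orthonormal basis `ψ₀⁺, ψ₀⁻, ψ₁⁺, ψ₁⁻` all operators involved are made of the
Pauli matrices `Z₀, X₀` of the span of `ψ₀⁺, ψ₀⁻` and of the Pauli matrix `Z₁` of the span of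
`ψ₁⁺, ψ₁⁻`. Partial transposition fixes `X₀` and exchanges `Z₀` with `-Z₁`, so that the identity
`H + H^Γ = Λ ⊗ Λ` becomes linear algebra. For the trace norms it suffices to exhibit a positive
operator whose square is `H²` or `(H^Γ)²`; both squares are combinations of the four projections
that occur in `absForm`.
-/

noncomputable section

namespace DataHiding

/-! ### Positive operators, measurements and the trace norm -/

lemma isStarProjection_posSemidef {n : Type} [Fintype n] [DecidableEq n] {P : Matrix n n ℂ}
    (h : P.IsHermitian) (hP : P * P = P) : P.PosSemidef := by
  have := posSemidef_conjTranspose_mul_self P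
  rwa [h.eq, hP] at this

lemma real_smul_posSemidef {n : Type} [Fintype n] {P : Matrix n n ℂ} (hP : P.PosSemidef) {r : ℝ}
    (hr : 0 ≤ r) : (r • P).PosSemidef := by
  classical
  exact (smul_nonneg hr hP.nonneg).posSemidef

lemma trace_mul_nonneg {n : Type} [Fintype n] [DecidableEq n] {P Q : Matrix n n ℂ}
    (hP : P.PosSemidef) (hQ : Q.PosSemidef) : 0 ≤ (P * Q).trace := by
  obtain ⟨B, rfl⟩ := CStarAlgebra.nonneg_iff_eq_star_mul_self.mp hP.nonneg
  rw [Matrix.mul_assoc, trace_mul_comm]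
  exact (hQ.mul_mul_conjTranspose_same B).trace_nonneg

lemma trace_mul_nonneg_re {n : Type} [Fintype n] [DecidableEq n] {P Q : Matrix n n ℂ}
    (hP : P.PosSemidef) (hQ : Q.PosSemidef) : 0 ≤ (P * Q).trace.re :=
  (Complex.nonneg_iff.mp (trace_mul_nonneg hP hQ)).1

lemma traceNorm_eq_of_mul_self {n : Type} [Fintype n] [DecidableEq n] {A S : Matrix n n ℂ}
    (hS : S.PosSemidef) (h : S * S = Aᴴ * A) : traceNorm A = S.trace.re := by
  have : CFC.abs A = S := CFC.sqrt_unique h hS.nonneg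
  rw [traceNorm, this]

/-- The operator `X` is a difference of two positive operators whose traces add up to `t`. For
Hermitian `X` the least such `t` is the trace norm, and the property is multiplicative under tensor
products. -/
def TraceBound {n : Type} [Fintype n] (X : Matrix n n ℂ) (t : ℝ) : Prop :=
  ∃ P N : Matrix n n ℂ, P.PosSemidef ∧ N.PosSemidef ∧ X = P - N ∧ P.trace + N.trace = (t : ℂ)

lemma TraceBound.nonneg {n : Type} [Fintype n] {X : Matrix n n ℂ} {t : ℝ}
    (h : TraceBound X t) : 0 ≤ t := by
  obtain ⟨P, N, hP, hN, -, ht⟩ := h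
  have := add_nonneg hP.trace_nonneg hN.trace_nonneg
  rw [ht] at this
  exact_mod_cast this

lemma traceBound_traceNorm {n : Type} [Fintype n] [DecidableEq n] {X : Matrix n n ℂ}
    (hX : X.IsHermitian) : TraceBound X (traceNorm X) := by
  have hX' : IsSelfAdjoint X := hX
  have hadd : X⁺ + X⁻ = CFC.abs X := CFC.posPart_add_negPart X
  refine ⟨X⁺, X⁻, (CFC.posPart_nonneg X).posSemidef, (CFC.negPart_nonneg X).posSemidef,
    (CFC.posPart_sub_negPart X).symm, ?_⟩
  rw [← trace_add, hadd, traceNorm]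
  have h : 0 ≤ (CFC.abs X).trace := (CFC.abs_nonneg X).posSemidef.trace_nonneg
  exact Complex.ext rfl (Complex.nonneg_iff.mp h).2.symm

/-- The duality between the trace norm and the operator norm, for the differences of the two
elements of a measurement. -/
lemma TraceBound.trace_mul_le {n : Type} [Fintype n] [DecidableEq n] {X M₀ M₁ : Matrix n n ℂ}
    {t : ℝ} (h : TraceBound X t) (h₀ : M₀.PosSemidef) (h₁ : M₁.PosSemidef) (hM : M₀ + M₁ = 1) :
    (X * (M₀ - M₁)).trace.re ≤ t := by
  obtain ⟨P, N, hP, hN, rfl, ht⟩ := h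
  have e₁ : P.trace = (P * M₀).trace + (P * M₁).trace := by
    rw [← trace_add, ← Matrix.mul_add, hM, Matrix.mul_one]
  have e₂ : N.trace = (N * M₀).trace + (N * M₁).trace := by
    rw [← trace_add, ← Matrix.mul_add, hM, Matrix.mul_one]
  have e₃ : t = (P * M₀).trace.re + (P * M₁).trace.re +
      ((N * M₀).trace.re + (N * M₁).trace.re) := by
    have := congrArg Complex.re ht
    rw [e₁, e₂] at this
    simpa using this.symm
  have := trace_mul_nonneg_re hP h₁
  have := trace_mul_nonneg_re hN h₀
  simp only [Matrix.sub_mul, Matrix.mul_sub, trace_sub, Complex.sub_re]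
  linarith

/-! ### Partial transposition and local operations -/

section PartialTranspose

variable {α β : Type}

lemma partialTranspose_add (M N : Matrix (α × β) (α × β) ℂ) :
    partialTranspose (M + N) = partialTranspose M + partialTranspose N := rfl

lemma partialTranspose_sub (M N : Matrix (α × β) (α × β) ℂ) :
    partialTranspose (M - N) = partialTranspose M - partialTranspose N := rfl

lemma partialTranspose_smul (r : ℝ) (M : Matrix (α × β) (α × β) ℂ) :
    partialTranspose (r • M) = r • partialTranspose M := rfl

lemma partialTranspose_sum {ι : Type} (s : Finset ι) (M : ι → Matrix (α × β) (α × β) ℂ) :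
    partialTranspose (∑ i ∈ s, M i) = ∑ i ∈ s, partialTranspose (M i) := by
  ext i j
  simp [partialTranspose, Matrix.sum_apply]

lemma partialTranspose_one [DecidableEq α] [DecidableEq β] :
    partialTranspose (1 : Matrix (α × β) (α × β) ℂ) = 1 := by
  ext ⟨a, b⟩ ⟨a', b'⟩
  simp [partialTranspose, Matrix.one_apply, eq_comm (a := b)]

lemma partialTranspose_isHermitian {M : Matrix (α × β) (α × β) ℂ} (h : M.IsHermitian) :
    (partialTranspose M).IsHermitian := by
  ext i j
  exact h.apply (i.1, j.2) (j.1, i.2)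

lemma trace_partialTranspose_mul [Fintype α] [Fintype β] (M N : Matrix (α × β) (α × β) ℂ) :
    (partialTranspose M * partialTranspose N).trace = (M * N).trace := by
  simp only [Matrix.trace, Matrix.diag, Matrix.mul_apply, Fintype.sum_prod_type, partialTranspose,
    Matrix.of_apply]
  refine Finset.sum_congr rfl fun a _ => ?_
  refine Finset.sum_comm.trans (Eq.trans ?_ Finset.sum_comm)
  exact Finset.sum_congr rfl fun a' _ => Finset.sum_comm

lemma partialTranspose_alice [Fintype β] [DecidableEq β] {γ : Type} [Fintype γ] (K : Matrix γ α ℂ)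
    (N : Matrix (γ × β) (γ × β) ℂ) :
    partialTranspose ((K ⊗ₖ (1 : Matrix β β ℂ))ᴴ * N * (K ⊗ₖ (1 : Matrix β β ℂ))) =
      (K ⊗ₖ (1 : Matrix β β ℂ))ᴴ * partialTranspose N * (K ⊗ₖ (1 : Matrix β β ℂ)) := by
  ext ⟨a, b⟩ ⟨a', b'⟩
  simp [partialTranspose, Matrix.mul_apply, Fintype.sum_prod_type, Matrix.one_apply,
    apply_ite (starRingEnd ℂ)]

lemma partialTranspose_bob [Fintype α] [DecidableEq α] {γ : Type} [Fintype γ] (K : Matrix γ β ℂ)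
    (N : Matrix (α × γ) (α × γ) ℂ) :
    partialTranspose (((1 : Matrix α α ℂ) ⊗ₖ K)ᴴ * N * ((1 : Matrix α α ℂ) ⊗ₖ K)) =
      ((1 : Matrix α α ℂ) ⊗ₖ K.map star)ᴴ * partialTranspose N *
        ((1 : Matrix α α ℂ) ⊗ₖ K.map star) := by
  ext ⟨a, b⟩ ⟨a', b'⟩
  simp only [partialTranspose, Matrix.mul_apply, Fintype.sum_prod_type, Matrix.one_apply,
    Matrix.of_apply, conjTranspose_apply, kroneckerMap_apply, Matrix.map_apply]
  simp [Finset.sum_mul, apply_ite (starRingEnd ℂ)]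
  rw [Finset.sum_comm]
  refine Finset.sum_congr rfl fun _ _ => Finset.sum_congr rfl fun _ _ => ?_
  ring

lemma isLOCC_isPPTMeasurement [Fintype α] [Fintype β] [DecidableEq α] [DecidableEq β]
    {κ : Type} [Fintype κ] [DecidableEq κ]
    {M : κ → Matrix (α × β) (α × β) ℂ} (h : IsLOCC α β M) : IsPPTMeasurement M := by
  induction h with
  | announce α β k =>
    refine ⟨⟨fun j => ?_, by simp⟩, fun j => ?_⟩
    · beta_reduce
      split_ifs
      exacts [PosSemidef.one, PosSemidef.zero]
    · beta_reduce
      split_ifs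
      · rw [partialTranspose_one]
        exact PosSemidef.one
      · exact PosSemidef.zero
  | alice α β n d K hK N hN ih =>
    refine ⟨⟨fun j => posSemidef_sum _ fun i _ => ((ih i).1.1 j).conjTranspose_mul_mul_same _, ?_⟩,
      fun j => ?_⟩
    · rw [Finset.sum_comm]
      simp only [← Matrix.sum_mul, ← Matrix.mul_sum, (ih _).1.2, Matrix.mul_one,
        conjTranspose_kronecker, ← mul_kronecker_mul, conjTranspose_one]
      rw [← one_kronecker_one, ← hK]
      ext i j
      simp [Matrix.sum_apply, Finset.sum_mul]
    · rw [partialTranspose_sum]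
      refine posSemidef_sum _ fun i _ => ?_
      rw [partialTranspose_alice]
      exact ((ih i).2 j).conjTranspose_mul_mul_same _
  | bob α β n d K hK N hN ih =>
    refine ⟨⟨fun j => posSemidef_sum _ fun i _ => ((ih i).1.1 j).conjTranspose_mul_mul_same _, ?_⟩,
      fun j => ?_⟩
    · rw [Finset.sum_comm]
      simp only [← Matrix.sum_mul, ← Matrix.mul_sum, (ih _).1.2, Matrix.mul_one,
        conjTranspose_kronecker, ← mul_kronecker_mul, conjTranspose_one]
      rw [← one_kronecker_one, ← hK]
      ext i j
      simp [Matrix.sum_apply, Finset.mul_sum]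
    · rw [partialTranspose_sum]
      refine posSemidef_sum _ fun i _ => ?_
      rw [partialTranspose_bob]
      exact ((ih i).2 j).conjTranspose_mul_mul_same _

end PartialTranspose

/-! ### Tensor products of two-party operators -/

section Tensor

variable {α β : Type}

lemma partialTranspose_tensor {L : ℕ} (X : Fin L → Matrix (α × β) (α × β) ℂ) :
    partialTranspose (tensor X) = tensor fun l => partialTranspose (X l) := rfl

lemma conjTranspose_tensor {L : ℕ} (X : Fin L → Matrix (α × β) (α × β) ℂ) :
    (tensor X)ᴴ = tensor fun l => (X l)ᴴ := by
  ext i j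
  simp [tensor]

lemma tensor_one [DecidableEq α] [DecidableEq β] {L : ℕ} :
    tensor (fun _ : Fin L => (1 : Matrix (α × β) (α × β) ℂ)) = 1 := by
  ext ⟨a, b⟩ ⟨a', b'⟩
  simp only [tensor, Matrix.of_apply, Matrix.one_apply, Prod.mk.injEq, Finset.prod_ite_zero,
    Finset.prod_const_one, funext_iff, Finset.mem_univ, true_imp_iff, forall_and]

lemma sum_prod_pair [Fintype α] [Fintype β] {L : ℕ} (f : Fin L → α × β → ℂ) :
    ∑ p : (Fin L → α) × (Fin L → β), ∏ l, f l (p.1 l, p.2 l) = ∏ l, ∑ x, f l x := by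
  rw [Fintype.prod_sum]
  exact (Fintype.sum_equiv (Equiv.arrowProdEquivProdArrow (Fin L) (fun _ => α) fun _ => β) _ _
    fun _ => rfl).symm

/-- Regrouping of the computational basis of `m + k` copies of a two-party system. -/
def splitEquiv (α β : Type) (m k : ℕ) :
    (Fin (m + k) → α) × (Fin (m + k) → β) ≃
      ((Fin m → α) × (Fin m → β)) × ((Fin k → α) × (Fin k → β)) :=
  ((Fin.appendEquiv m k).symm.prodCongr (Fin.appendEquiv m k).symm).trans
    (Equiv.prodProdProdComm _ _ _ _)

/-- The tensor product of an operator on `m` copies and one on `k` copies, with the systems of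
Alice and those of Bob grouped together. -/
def join {m k : ℕ} (X : Matrix ((Fin m → α) × (Fin m → β)) ((Fin m → α) × (Fin m → β)) ℂ)
    (Y : Matrix ((Fin k → α) × (Fin k → β)) ((Fin k → α) × (Fin k → β)) ℂ) :
    Matrix ((Fin (m + k) → α) × (Fin (m + k) → β)) ((Fin (m + k) → α) × (Fin (m + k) → β)) ℂ :=
  (X ⊗ₖ Y).submatrix (splitEquiv α β m k) (splitEquiv α β m k)

variable {m k : ℕ}

lemma join_tensor (Z : Matrix (α × β) (α × β) ℂ) :
    join (tensor fun _ : Fin m => Z) (tensor fun _ : Fin k => Z) =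
      tensor fun _ : Fin (m + k) => Z := by
  ext i j
  simp only [tensor, Matrix.of_apply, Fin.prod_univ_add]
  rfl

variable [Fintype α] [Fintype β]

lemma tensor_mul_tensor {L : ℕ} (X Y : Fin L → Matrix (α × β) (α × β) ℂ) :
    tensor X * tensor Y = tensor fun l => X l * Y l := by
  ext i j
  simp only [tensor, Matrix.mul_apply, Matrix.of_apply, ← Finset.prod_mul_distrib]
  exact sum_prod_pair fun l x => X l (i.1 l, i.2 l) x * Y l x (j.1 l, j.2 l)

lemma trace_tensor {L : ℕ} (X : Fin L → Matrix (α × β) (α × β) ℂ) :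
    (tensor X).trace = ∏ l, (X l).trace :=
  sum_prod_pair fun l x => X l x x

lemma tensor_posSemidef {L : ℕ} {X : Fin L → Matrix (α × β) (α × β) ℂ}
    (h : ∀ l, (X l).PosSemidef) : (tensor X).PosSemidef := by
  classical
  choose B hB using fun l => CStarAlgebra.nonneg_iff_eq_star_mul_self.mp (h l).nonneg
  have : tensor X = (tensor B)ᴴ * tensor B := by
    rw [conjTranspose_tensor, tensor_mul_tensor]
    exact congrArg tensor (funext hB)
  rw [this]
  exact posSemidef_conjTranspose_mul_self _

/-- Tensor products multiply trace bounds: if `X = P - N` and `Y = P' - N'`, then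
`X ⊗ Y = (P ⊗ P' + N ⊗ N') - (P ⊗ N' + N ⊗ P')`. -/
lemma TraceBound.join
    {X : Matrix ((Fin m → α) × (Fin m → β)) ((Fin m → α) × (Fin m → β)) ℂ}
    {Y : Matrix ((Fin k → α) × (Fin k → β)) ((Fin k → α) × (Fin k → β)) ℂ} {s t : ℝ}
    (hX : TraceBound X s) (hY : TraceBound Y t) : TraceBound (DataHiding.join X Y) (s * t) := by
  obtain ⟨P, N, hP, hN, rfl, hs⟩ := hX
  obtain ⟨P', N', hP', hN', rfl, ht⟩ := hY
  have htr : ∀ A B, (DataHiding.join (m := m) (k := k) (α := α) (β := β) A B).trace =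
      A.trace * B.trace := by
    intro A B
    rw [← trace_kronecker]
    exact Fintype.sum_equiv (splitEquiv α β m k) _ _ fun _ => rfl
  refine ⟨DataHiding.join P P' + DataHiding.join N N', DataHiding.join P N' + DataHiding.join N P',
    ((hP.kronecker hP').submatrix _).add ((hN.kronecker hN').submatrix _),
    ((hP.kronecker hN').submatrix _).add ((hN.kronecker hP').submatrix _), ?_, ?_⟩
  · ext i j
    simp [DataHiding.join]
    ring
  · rw [trace_add, trace_add, htr, htr, htr, htr]
    push_cast
    rw [← hs, ← ht]
    ring

end Tensor

/-! ### Guessing the parity of a string of states -/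

/-- The sign `(-1) ^ i` of a bit `i`. -/
def bitSign (i : ZMod 2) : ℝ := if i = 0 then 1 else -1

lemma zmod_two_cases : ∀ i : ZMod 2, i = 0 ∨ i = 1 := by decide

lemma zmod_two_one_add_one : (1 : ZMod 2) + 1 = 0 := by decide

lemma bitSign_zero : bitSign 0 = 1 := if_pos rfl

lemma bitSign_one : bitSign 1 = -1 := if_neg (by decide)

lemma bitSign_add (i j : ZMod 2) : bitSign (i + j) = bitSign i * bitSign j := by
  rcases zmod_two_cases i with rfl | rfl <;> rcases zmod_two_cases j with rfl | rfl <;>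
    simp [bitSign_zero, bitSign_one, zmod_two_one_add_one]

lemma bitSign_sum {ι : Type} (s : Finset ι) (b : ι → ZMod 2) :
    bitSign (∑ l ∈ s, b l) = ∏ l ∈ s, bitSign (b l) := by
  classical
  induction s using Finset.induction_on with
  | empty => simp [bitSign]
  | insert a s ha ih => rw [Finset.sum_insert ha, Finset.prod_insert ha, bitSign_add, ih]

lemma zmod_two_sum {R : Type} [AddCommMonoid R] (f : ZMod 2 → R) : ∑ i, f i = f 0 + f 1 :=
  Fin.sum_univ_two f

section Ensemble

variable {α β : Type} (η : ZMod 2 → ℝ) (ρ : ZMod 2 → Matrix (α × β) (α × β) ℂ)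

/-- A tensor power of `η₀ρ₀ - η₁ρ₁` expands into the strings, signed by their parity. -/
lemma tensor_lam (L : ℕ) :
    tensor (fun _ : Fin L => lam η ρ) =
      ∑ b : Fin L → ZMod 2, (bitSign (∑ l, b l) * probStr η b) • stateStr ρ b := by
  have h : lam η ρ = ∑ i, (bitSign i * η i) • ρ i := by
    rw [zmod_two_sum]
    simp [lam, bitSign, sub_eq_add_neg]
  ext i j
  simp only [tensor, h, Matrix.of_apply, Matrix.sum_apply, Fintype.prod_sum, stateStr, probStr,
    Matrix.smul_apply, bitSign_sum, ← Finset.prod_mul_distrib, Complex.real_smul]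
  push_cast
  simp only [← Finset.prod_mul_distrib]

lemma sum_probStr (hη : ∑ i, η i = 1) (L : ℕ) : ∑ b : Fin L → ZMod 2, probStr η b = 1 := by
  simp only [probStr]
  rw [← Fintype.prod_sum fun (_ : Fin L) i => η i]
  simp [hη]

lemma probStr_nonneg (hη : ∀ i, 0 ≤ η i) {L : ℕ} (b : Fin L → ZMod 2) : 0 ≤ probStr η b :=
  Finset.prod_nonneg fun _ _ => hη _

/-- The defining relation of the average states holds also when the parity has probability zero. -/
lemma probPar_smul_statePar (hη : ∀ i, 0 ≤ η i) (L : ℕ) (i : ZMod 2) :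
    probPar η L i • statePar η ρ L i =
      ∑ b : Fin L → ZMod 2 with ∑ l, b l = i, probStr η b • stateStr ρ b := by
  rw [statePar, smul_smul]
  by_cases h : probPar η L i = 0
  · have h' := (Finset.sum_eq_zero_iff_of_nonneg fun b _ => probStr_nonneg η hη b).mp h
    rw [h, zero_mul, zero_smul]
    exact (Finset.sum_eq_zero fun b hb => by rw [h' b hb, zero_smul]).symm
  · rw [mul_one_div_cancel h, one_smul]

variable [Fintype α] [Fintype β]

lemma success_par (hη : ∀ i, 0 ≤ η i) {L : ℕ}
    (M : ZMod 2 → Matrix ((Fin L → α) × (Fin L → β)) ((Fin L → α) × (Fin L → β)) ℂ) :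
    success (probPar η L) (statePar η ρ L) M =
      ∑ b : Fin L → ZMod 2, probStr η b * (stateStr ρ b * M (∑ l, b l)).trace.re := by
  rw [← Finset.sum_fiberwise Finset.univ fun b : Fin L → ZMod 2 => ∑ l, b l, success]
  refine Finset.sum_congr rfl fun i _ => ?_
  have h : probPar η L i * (statePar η ρ L i * M i).trace.re =
      ((probPar η L i • statePar η ρ L i) * M i).trace.re := by
    rw [Matrix.smul_mul, trace_smul, Complex.smul_re, smul_eq_mul]
  rw [h, probPar_smul_statePar η ρ hη, Matrix.sum_mul, trace_sum, Complex.re_sum]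
  refine Finset.sum_congr rfl fun b hb => ?_
  rw [(Finset.mem_filter.mp hb).2, Matrix.smul_mul, trace_smul, Complex.smul_re, smul_eq_mul]

lemma trace_stateStr (hρ : ∀ i, (ρ i).trace = 1) {L : ℕ} (b : Fin L → ZMod 2) :
    (stateStr ρ b).trace = 1 := by
  simp [stateStr, trace_tensor, hρ]

variable [DecidableEq α] [DecidableEq β]

lemma success_add_success (hη : ∀ i, 0 ≤ η i) (hη' : ∑ i, η i = 1) (hρ : ∀ i, (ρ i).trace = 1)
    {L : ℕ} {M N : ZMod 2 → Matrix ((Fin L → α) × (Fin L → β)) ((Fin L → α) × (Fin L → β)) ℂ}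
    (h : ∀ i, M i + N i = 1) :
    success (probPar η L) (statePar η ρ L) M + success (probPar η L) (statePar η ρ L) N = 1 := by
  rw [success_par η ρ hη, success_par η ρ hη, ← Finset.sum_add_distrib, ← sum_probStr η hη' L]
  refine Finset.sum_congr rfl fun b _ => ?_
  rw [← mul_add, ← Complex.add_re, ← trace_add, ← Matrix.mul_add, h, Matrix.mul_one,
    trace_stateStr ρ hρ, Complex.one_re, mul_one]

/-- The advantage over random guessing is governed by the `L`-th tensor power of `η₀ρ₀ - η₁ρ₁`. -/
lemma success_eq (hη : ∀ i, 0 ≤ η i) (hη' : ∑ i, η i = 1) (hρ : ∀ i, (ρ i).trace = 1) {L : ℕ}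
    {M : ZMod 2 → Matrix ((Fin L → α) × (Fin L → β)) ((Fin L → α) × (Fin L → β)) ℂ}
    (hM : M 0 + M 1 = 1) :
    success (probPar η L) (statePar η ρ L) M =
      1 / 2 + 1 / 2 * (tensor (fun _ : Fin L => lam η ρ) * (M 0 - M 1)).trace.re := by
  have key : ∀ i, M i = (1 / 2 : ℝ) • (1 + bitSign i • (M 0 - M 1)) := by
    intro i
    rw [← hM]
    rcases zmod_two_cases i with rfl | rfl
    · rw [bitSign_zero]
      module
    · rw [bitSign_one]
      module
  have h : (1 / 2 : ℝ) = ∑ b : Fin L → ZMod 2, probStr η b * (1 / 2) := by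
    rw [← Finset.sum_mul, sum_probStr η hη', one_mul]
  rw [success_par η ρ hη, tensor_lam, Matrix.sum_mul, trace_sum, Complex.re_sum, Finset.mul_sum]
  nth_rw 1 [h]
  rw [← Finset.sum_add_distrib]
  refine Finset.sum_congr rfl fun b _ => ?_
  rw [key (∑ l, b l), Matrix.mul_smul, Matrix.mul_add, Matrix.mul_one, Matrix.mul_smul,
    Matrix.smul_mul, trace_smul, trace_add, trace_smul, trace_stateStr ρ hρ, trace_smul]
  simp only [Complex.smul_re, Complex.add_re, Complex.one_re, smul_eq_mul]
  ring

lemma success_le_one (hη : ∀ i, 0 ≤ η i) (hη' : ∑ i, η i = 1) (hρ : ∀ i, IsState (ρ i)) {L : ℕ}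
    {M : ZMod 2 → Matrix ((Fin L → α) × (Fin L → β)) ((Fin L → α) × (Fin L → β)) ℂ}
    (hM : IsMeasurement M) : success (probPar η L) (statePar η ρ L) M ≤ 1 := by
  have hM' : M 0 + M 1 = 1 := by rw [← hM.2, zmod_two_sum]
  -- the measurement with exchanged outcomes errs where `M` succeeds
  have h0 : 0 ≤ success (probPar η L) (statePar η ρ L) fun i => M (i + 1) := by
    rw [success_par η ρ hη]
    exact Finset.sum_nonneg fun b _ => mul_nonneg (probStr_nonneg η hη b)
      (trace_mul_nonneg_re (tensor_posSemidef fun l => (hρ _).1) (hM.1 _))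
  have h1 := success_add_success η ρ hη hη' (fun i => (hρ i).2) (M := M)
    (N := fun i => M (i + 1)) (by
      intro i
      rcases zmod_two_cases i with rfl | rfl
      · simpa using hM'
      · simpa [zmod_two_one_add_one, add_comm] using hM')
  linarith

/-- One of the two constant guesses is right with probability at least `1 / 2`. -/
lemma half_le_pL (hη : ∀ i, 0 ≤ η i) (hη' : ∑ i, η i = 1) (hρ : ∀ i, IsState (ρ i)) (L : ℕ) :
    1 / 2 ≤ pL (probPar η L) (statePar η ρ L) := by
  have hb : BddAbove {p | ∃ M : ZMod 2 → _, IsLOCC (Fin L → α) (Fin L → β) M ∧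
      p = success (probPar η L) (statePar η ρ L) M} := by
    refine ⟨1, ?_⟩
    rintro p ⟨M, hM, rfl⟩
    exact success_le_one η ρ hη hη' hρ (isLOCC_isPPTMeasurement hM).1
  have h := success_add_success η ρ hη hη' (fun i => (hρ i).2) (L := L)
    (M := fun j => if j = 0 then 1 else 0) (N := fun j => if j = 1 then 1 else 0) (by
      intro i
      rcases zmod_two_cases i with rfl | rfl <;> simp)
  have h0 := le_csSup hb ⟨_, IsLOCC.announce (Fin L → α) (Fin L → β) 0, rfl⟩
  have h1 := le_csSup hb ⟨_, IsLOCC.announce (Fin L → α) (Fin L → β) 1, rfl⟩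
  rw [pL]
  linarith

lemma pL_le_pPPT (hη : ∀ i, 0 ≤ η i) (hη' : ∑ i, η i = 1) (hρ : ∀ i, IsState (ρ i)) (L : ℕ) :
    pL (probPar η L) (statePar η ρ L) ≤ pPPT (probPar η L) (statePar η ρ L) := by
  refine csSup_le_csSup ⟨1, ?_⟩ ⟨_, _, IsLOCC.announce _ _ 0, rfl⟩ ?_
  · rintro p ⟨M, hM, rfl⟩
    exact success_le_one η ρ hη hη' hρ hM.1
  · rintro p ⟨M, hM, rfl⟩
    exact ⟨M, isLOCC_isPPTMeasurement hM, rfl⟩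

/-! ### Perfect global discrimination -/

/-- If an observable `T` with values `±1` identifies the two states with certainty, then
`T ⊗ ⋯ ⊗ T` identifies the parity of a string with certainty. -/
lemma exists_perfect_measurement (hη : ∀ i, 0 ≤ η i) (hη' : ∑ i, η i = 1)
    (hρ : ∀ i, (ρ i).trace = 1) {T : Matrix (α × β) (α × β) ℂ} (hT : T.IsHermitian)
    (hT' : T * T = 1) (htr : (lam η ρ * T).trace = 1) (L : ℕ) :
    ∃ M : ZMod 2 → Matrix ((Fin L → α) × (Fin L → β)) ((Fin L → α) × (Fin L → β)) ℂ,
      IsMeasurement M ∧ success (probPar η L) (statePar η ρ L) M = 1 := by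
  set S := tensor fun _ : Fin L => T with hS
  have h1 : S.IsHermitian := by
    rw [IsHermitian, hS, conjTranspose_tensor, hT.eq]
  have h2 : S * S = 1 := by rw [hS, tensor_mul_tensor, hT', tensor_one]
  have hproj : ∀ r : ℝ, r * r = 1 → ((1 / 2 : ℝ) • (1 + r • S)).PosSemidef := by
    intro r hr
    refine isStarProjection_posSemidef ?_ ?_
    · rw [IsHermitian, conjTranspose_smul, conjTranspose_add, conjTranspose_smul, h1.eq]
      simp
    · simp only [Matrix.smul_mul, Matrix.mul_smul, Matrix.add_mul, Matrix.mul_add, h2,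
        Matrix.one_mul, Matrix.mul_one, smul_smul, smul_add]
      match_scalars
      · linear_combination (1 / 4) * hr
      · ring
  refine ⟨fun i => (1 / 2 : ℝ) • (1 + bitSign i • S), ⟨fun i => hproj _ ?_, ?_⟩, ?_⟩
  · rw [bitSign]
    split_ifs <;> norm_num
  · rw [zmod_two_sum]
    simp only [bitSign_zero, bitSign_one]
    module
  · have e : (1 / 2 : ℝ) • (1 + bitSign 0 • S) - (1 / 2 : ℝ) • (1 + bitSign 1 • S) = S := by
      simp only [bitSign_zero, bitSign_one]
      module
    rw [success_eq η ρ hη hη' hρ, e, hS, tensor_mul_tensor, trace_tensor]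
    · norm_num [htr]
    · simp only [bitSign_zero, bitSign_one]
      module

lemma pG_eq_one (hη : ∀ i, 0 ≤ η i) (hη' : ∑ i, η i = 1) (hρ : ∀ i, IsState (ρ i)) {L : ℕ}
    (h : ∃ M : ZMod 2 → Matrix ((Fin L → α) × (Fin L → β)) ((Fin L → α) × (Fin L → β)) ℂ,
      IsMeasurement M ∧ success (probPar η L) (statePar η ρ L) M = 1) :
    pG (probPar η L) (statePar η ρ L) = 1 := by
  obtain ⟨M, hM, h⟩ := h
  refine IsGreatest.csSup_eq ⟨⟨M, hM, h.symm⟩, ?_⟩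
  rintro p ⟨N, hN, rfl⟩
  exact success_le_one η ρ hη hη' hρ hN

/-! ### The bound for PPT measurements -/

/-- `Y` is a sum of `2 ^ m` operators such that each of them and its partial transpose have trace
bounds with product `c ^ m`. -/
def SplitBound {γ δ : Type} [Fintype γ] [Fintype δ] (c : ℝ) (m : ℕ)
    (Y : Matrix (γ × δ) (γ × δ) ℂ) : Prop :=
  ∃ (ι : Type) (_ : Fintype ι) (X : ι → Matrix (γ × δ) (γ × δ) ℂ),
    Fintype.card ι = 2 ^ m ∧ Y = ∑ i, X i ∧ ∀ i, ∃ a b : ℝ, a * b = c ^ m ∧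
      TraceBound (X i) a ∧ TraceBound (partialTranspose (X i)) b

/-- A PPT measurement gains from a term of the splitting at most the smaller of the two trace bounds,
hence at most their geometric mean. -/
lemma SplitBound.trace_mul_le {γ δ : Type} [Fintype γ] [Fintype δ] [DecidableEq γ] [DecidableEq δ]
    {c : ℝ} {m : ℕ} {Y : Matrix (γ × δ) (γ × δ) ℂ} (h : SplitBound c m Y)
    {M : ZMod 2 → Matrix (γ × δ) (γ × δ) ℂ} (hM : IsPPTMeasurement M) :
    (Y * (M 0 - M 1)).trace.re ≤ √((4 * c) ^ m) := by
  obtain ⟨ι, _, X, hcard, rfl, hX⟩ := h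
  have hM' : M 0 + M 1 = 1 := by rw [← hM.1.2, zmod_two_sum]
  have hterm : ∀ i, (X i * (M 0 - M 1)).trace.re ≤ √(c ^ m) := by
    intro i
    obtain ⟨a, b, hab, ha, hb⟩ := hX i
    have h1 := ha.trace_mul_le (hM.1.1 0) (hM.1.1 1) hM'
    have h2 := hb.trace_mul_le (hM.2 0) (hM.2 1)
      (by rw [← partialTranspose_add, hM', partialTranspose_one])
    rw [← partialTranspose_sub, trace_partialTranspose_mul] at h2
    by_cases hx : 0 ≤ (X i * (M 0 - M 1)).trace.re
    · refine Real.le_sqrt_of_sq_le ?_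
      rw [← hab, sq]
      exact mul_le_mul h1 h2 hx ha.nonneg
    · exact (not_le.mp hx).le.trans (Real.sqrt_nonneg _)
  have h4 : √((4 : ℝ) ^ m) = 2 ^ m := by
    rw [show (4 : ℝ) = 2 ^ 2 by norm_num, ← pow_mul, mul_comm, pow_mul]
    exact Real.sqrt_sq (by positivity)
  rw [Matrix.sum_mul, trace_sum, Complex.re_sum, mul_pow, Real.sqrt_mul (by positivity), h4]
  calc ∑ i, (X i * (M 0 - M 1)).trace.re ≤ ∑ _i : ι, √(c ^ m) :=
        Finset.sum_le_sum fun i _ => hterm i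
    _ = 2 ^ m * √(c ^ m) := by simp [hcard]

omit [DecidableEq α] [DecidableEq β] in
lemma SplitBound.join {k L : ℕ} {c : ℝ} {m : ℕ}
    {Y : Matrix ((Fin L → α) × (Fin L → β)) ((Fin L → α) × (Fin L → β)) ℂ}
    {H : Matrix ((Fin k → α) × (Fin k → β)) ((Fin k → α) × (Fin k → β)) ℂ} {s t : ℝ}
    (h : SplitBound c m Y) (hs : TraceBound H s) (ht : TraceBound (partialTranspose H) t)
    (hc : s * t = c) :
    SplitBound c (m + 1) (DataHiding.join Y (H + partialTranspose H)) := by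
  obtain ⟨ι, _, X, hcard, rfl, hX⟩ := h
  refine ⟨ι × Bool, inferInstance, fun p =>
    DataHiding.join (X p.1) (if p.2 then H else partialTranspose H), ?_, ?_, ?_⟩
  · rw [Fintype.card_prod, hcard, Fintype.card_bool, pow_succ]
  · rw [Fintype.sum_prod_type]
    ext i j
    simp [DataHiding.join, Matrix.sum_apply, Finset.sum_mul, Finset.sum_add_distrib, mul_add]
  · rintro ⟨i, u⟩
    obtain ⟨a, b, hab, ha, hb⟩ := hX i
    cases u
    -- appending a factor `H^Γ` multiplies the two bounds by `t` and `s`, a factor `H` by `s` and `t`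
    · refine ⟨a * t, b * s, ?_, ha.join ht, hb.join hs⟩
      rw [pow_succ, ← hab, ← hc]
      ring
    · refine ⟨a * s, b * t, ?_, ha.join hs, hb.join ht⟩
      rw [pow_succ, ← hab, ← hc]
      ring

variable {η ρ}

lemma splitBound_tensor_lam (hη : ∀ i, 0 ≤ η i) (hη' : ∑ i, η i = 1) (hρ : ∀ i, IsState (ρ i))
    (hΓ : partialTranspose (lam η ρ) = lam η ρ)
    {H : Matrix ((Fin 2 → α) × (Fin 2 → β)) ((Fin 2 → α) × (Fin 2 → β)) ℂ} (hH : H.IsHermitian)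
    (hsum : H + partialTranspose H = tensor (fun _ : Fin 2 => lam η ρ)) (r : ℕ) (hr : r ≤ 1)
    (m : ℕ) :
    SplitBound (traceNorm H * traceNorm (partialTranspose H)) m
      (tensor fun _ : Fin (r + 2 * m) => lam η ρ) := by
  induction m with
  | zero =>
    -- the empty tensor product is `1`; a single factor is `η₀ρ₀ - η₁ρ₁`, split as it is written
    have hb : TraceBound (tensor fun _ : Fin r => lam η ρ) 1 := by
      interval_cases r
      · refine ⟨1, 0, PosSemidef.one, PosSemidef.zero, ?_, by simp⟩
        ext i j
        simp [tensor, Subsingleton.elim i j]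
      · refine ⟨tensor fun _ => η 0 • ρ 0, tensor fun _ => η 1 • ρ 1,
          tensor_posSemidef fun _ => real_smul_posSemidef (hρ 0).1 (hη 0),
          tensor_posSemidef fun _ => real_smul_posSemidef (hρ 1).1 (hη 1), ?_, ?_⟩
        · ext i j
          simp [tensor, lam]
        · rw [zmod_two_sum] at hη'
          rw [trace_tensor, trace_tensor, ← hη']
          simp [trace_smul, (hρ _).2]
    refine ⟨Unit, inferInstance, fun _ => tensor fun _ => lam η ρ, by simp, by simp, fun _ =>
      ⟨1, 1, by simp, hb, ?_⟩⟩
    rw [partialTranspose_tensor]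
    simp only [hΓ]
    exact hb
  | succ m ih =>
    have := ih.join (traceBound_traceNorm hH)
      (traceBound_traceNorm (partialTranspose_isHermitian hH)) rfl
    rwa [hsum, join_tensor] at this

/-- With `L = r + 2 * m` and `r ≤ 1`, the splitting bounds the advantage by `q ^ (m / 2)`; the
exponent `m / 2 = (L - r) / 4` is at least `(L - 1) / 4`. -/
lemma success_le_of_ppt (hη : ∀ i, 0 ≤ η i) (hη' : ∑ i, η i = 1) (hρ : ∀ i, IsState (ρ i))
    (hΓ : partialTranspose (lam η ρ) = lam η ρ)
    {H : Matrix ((Fin 2 → α) × (Fin 2 → β)) ((Fin 2 → α) × (Fin 2 → β)) ℂ} (hH : H.IsHermitian)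
    (hsum : H + partialTranspose H = tensor (fun _ : Fin 2 => lam η ρ))
    {q : ℝ} (hq : 4 * traceNorm H * traceNorm (partialTranspose H) = q) (hq0 : 0 < q) (hq1 : q < 1)
    {L : ℕ}
    {M : ZMod 2 → Matrix ((Fin L → α) × (Fin L → β)) ((Fin L → α) × (Fin L → β)) ℂ}
    (hM : IsPPTMeasurement M) :
    success (probPar η L) (statePar η ρ L) M ≤ 1 / 2 + 1 / 2 * q ^ (((L : ℝ) - 1) / 4) := by
  obtain ⟨r, m, hr, rfl⟩ : ∃ r m, r ≤ 1 ∧ L = r + 2 * m :=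
    ⟨L % 2, L / 2, by omega, (Nat.mod_add_div L 2).symm⟩
  rw [success_eq η ρ hη hη' (fun i => (hρ i).2) (by rw [← hM.1.2, zmod_two_sum])]
  have h := (splitBound_tensor_lam hη hη' hρ hΓ hH hsum r hr m).trace_mul_le hM
  rw [← mul_assoc, hq] at h
  have h' : √(q ^ m) ≤ q ^ ((((r + 2 * m : ℕ) : ℝ) - 1) / 4) := by
    rw [Real.sqrt_eq_rpow, ← Real.rpow_natCast, ← Real.rpow_mul hq0.le]
    refine Real.rpow_le_rpow_of_exponent_ge hq0 hq1.le ?_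
    have : (r : ℝ) ≤ 1 := by exact_mod_cast hr
    push_cast
    linarith
  linarith

lemma pPPT_le (hη : ∀ i, 0 ≤ η i) (hη' : ∑ i, η i = 1) (hρ : ∀ i, IsState (ρ i))
    (hΓ : partialTranspose (lam η ρ) = lam η ρ)
    {H : Matrix ((Fin 2 → α) × (Fin 2 → β)) ((Fin 2 → α) × (Fin 2 → β)) ℂ} (hH : H.IsHermitian)
    (hsum : H + partialTranspose H = tensor (fun _ : Fin 2 => lam η ρ))
    {q : ℝ} (hq : 4 * traceNorm H * traceNorm (partialTranspose H) = q) (hq0 : 0 < q) (hq1 : q < 1)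
    (L : ℕ) :
    pPPT (probPar η L) (statePar η ρ L) ≤ 1 / 2 + 1 / 2 * q ^ (((L : ℝ) - 1) / 4) := by
  refine csSup_le ⟨_, _, isLOCC_isPPTMeasurement (IsLOCC.announce _ _ 0), rfl⟩ ?_
  rintro p ⟨M, hM, rfl⟩
  exact success_le_of_ppt hη hη' hρ hΓ hH hsum hq hq0 hq1 hM

lemma tendsto_half_add {q : ℝ} (hq0 : 0 < q) (hq1 : q < 1) :
    Tendsto (fun L : ℕ => 1 / 2 + 1 / 2 * q ^ (((L : ℝ) - 1) / 4)) atTop (𝓝 (1 / 2)) := by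
  have h1 : Tendsto (fun L : ℕ => ((L : ℝ) - 1) / 4) atTop atTop :=
    (tendsto_atTop_add_const_right _ (-1) tendsto_natCast_atTop_atTop).atTop_div_const
      (by norm_num)
  have h2 := (tendsto_rpow_atTop_of_base_lt_one q (by linarith) hq1).comp h1
  have h3 := (h2.const_mul (1 / 2)).const_add (1 / 2)
  rwa [mul_zero, add_zero] at h3

/-! ### The hiding protocol -/

variable (η ρ)

omit [DecidableEq α] [DecidableEq β] in
/-- Guessing the hidden bit from the broadcast `z` amounts to guessing the parity of the string. -/
lemma recoverProb_add_recoverProb (hη : ∀ i, 0 ≤ η i) {L : ℕ}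
    (M : ZMod 2 → ZMod 2 → Matrix ((Fin L → α) × (Fin L → β)) ((Fin L → α) × (Fin L → β)) ℂ) :
    recoverProb η ρ L M 0 + recoverProb η ρ L M 1 =
      success (probPar η L) (statePar η ρ L) (fun i => M 0 (i + 0)) +
        success (probPar η L) (statePar η ρ L) fun i => M 1 (i + 1) := by
  simp only [success_par η ρ hη, recoverProb, ← Finset.sum_add_distrib]
  refine Finset.sum_congr rfl fun b _ => ?_
  generalize ∑ l, b l = i
  rcases zmod_two_cases i with rfl | rfl
  · simp
  · simp [zmod_two_one_add_one, add_comm]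

lemma hidesOneBit_of_bound (hη : ∀ i, 0 ≤ η i)
    (hG : ∀ L : ℕ, ∃ M : ZMod 2 →
        Matrix ((Fin L → α) × (Fin L → β)) ((Fin L → α) × (Fin L → β)) ℂ,
      IsMeasurement M ∧ success (probPar η L) (statePar η ρ L) M = 1)
    {f : ℕ → ℝ} (hf : Tendsto f atTop (𝓝 (1 / 2)))
    (hP : ∀ (L : ℕ) (M : ZMod 2 →
        Matrix ((Fin L → α) × (Fin L → β)) ((Fin L → α) × (Fin L → β)) ℂ),
      IsPPTMeasurement M → success (probPar η L) (statePar η ρ L) M ≤ f L) :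
    HidesOneBit η ρ := by
  refine ⟨fun L _ => ?_, fun ε hε => ?_⟩
  · obtain ⟨M, hM, h⟩ := hG L
    refine ⟨fun z x => M (x + z), fun z => ⟨fun k => hM.1 _, ?_⟩, fun x => ?_⟩
    · rw [← hM.2]
      exact Equiv.sum_comp (Equiv.addRight z) M
    · rw [← h, success_par η ρ hη, recoverProb]
      refine Finset.sum_congr rfl fun b _ => ?_
      rw [← add_assoc, CharTwo.add_self_eq_zero, zero_add]
  · obtain ⟨L₀, hL₀⟩ := eventually_atTop.mp
      (hf.eventually (gt_mem_nhds (lt_add_of_pos_right (1 / 2 : ℝ) hε)))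
    refine ⟨L₀, fun L hL M hM => ?_⟩
    have hz : ∀ z, success (probPar η L) (statePar η ρ L) (fun i => M z (i + z)) ≤ f L := by
      intro z
      have h := isLOCC_isPPTMeasurement (hM z)
      refine hP L _ ⟨⟨fun k => h.1.1 _, ?_⟩, fun k => h.2 _⟩
      rw [← h.1.2]
      exact Equiv.sum_comp (Equiv.addRight z) (M z)
    have := recoverProb_add_recoverProb η ρ hη M
    linarith [hz 0, hz 1, hL₀ L hL]

end Ensemble

/-! ### Rank-one operators and products of two two-qubit operators -/

section KetBra

variable {n : Type}

lemma ketBra_apply (v w : n → ℂ) (i j : n) : ketBra v w i j = v i * star (w j) := rfl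

lemma ketBra_add_left (u v w : n → ℂ) : ketBra (u + v) w = ketBra u w + ketBra v w := by
  ext i j
  simp [ketBra_apply, add_mul]

lemma ketBra_add_right (u v w : n → ℂ) : ketBra u (v + w) = ketBra u v + ketBra u w := by
  ext i j
  simp [ketBra_apply, mul_add]

lemma ketBra_sub_left (u v w : n → ℂ) : ketBra (u - v) w = ketBra u w - ketBra v w := by
  ext i j
  simp [ketBra_apply, sub_mul]

lemma ketBra_sub_right (u v w : n → ℂ) : ketBra u (v - w) = ketBra u v - ketBra u w := by
  ext i j
  simp [ketBra_apply, mul_sub]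

lemma ketBra_smul_left (r : ℝ) (u v : n → ℂ) : ketBra (r • u) v = r • ketBra u v := by
  ext i j
  simp [ketBra_apply, mul_assoc]

lemma ketBra_smul_right (r : ℝ) (u v : n → ℂ) : ketBra u (r • v) = r • ketBra u v := by
  ext i j
  simp [ketBra_apply, mul_left_comm]

lemma ketBra_posSemidef [Finite n] (v : n → ℂ) : (ketBra v v).PosSemidef :=
  posSemidef_vecMulVec_self_star v

lemma ketBra_mul_ketBra_of_orthogonal [Fintype n] {u v w x : n → ℂ} (h : star v ⬝ᵥ w = 0) :
    ketBra u v * ketBra w x = 0 := by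
  simp [ketBra, vecMulVec_mul_vecMulVec, h]

end KetBra

/-- The tensor product of two two-qubit operators, with the qubits of Alice and those of Bob
grouped together. -/
def pair (A B : Matrix (Fin 2 × Fin 2) (Fin 2 × Fin 2) ℂ) :
    Matrix ((Fin 2 → Fin 2) × (Fin 2 → Fin 2)) ((Fin 2 → Fin 2) × (Fin 2 → Fin 2)) ℂ :=
  tensor ![A, B]

section Pair

variable (A B C D : Matrix (Fin 2 × Fin 2) (Fin 2 × Fin 2) ℂ)

lemma pair_apply (i j : (Fin 2 → Fin 2) × (Fin 2 → Fin 2)) :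
    pair A B i j = A (i.1 0, i.2 0) (j.1 0, j.2 0) * B (i.1 1, i.2 1) (j.1 1, j.2 1) := by
  simp [pair, tensor]

lemma tensor_two : tensor (fun _ : Fin 2 => A) = pair A A := by
  ext i j
  simp [pair_apply, tensor]

lemma pair_add_left : pair (A + B) C = pair A C + pair B C := by
  ext i j
  simp [pair_apply, add_mul]

lemma pair_add_right : pair A (B + C) = pair A B + pair A C := by
  ext i j
  simp [pair_apply, mul_add]

lemma pair_sub_left : pair (A - B) C = pair A C - pair B C := by
  ext i j
  simp [pair_apply, sub_mul]

lemma pair_sub_right : pair A (B - C) = pair A B - pair A C := by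
  ext i j
  simp [pair_apply, mul_sub]

lemma pair_neg_left : pair (-A) B = -pair A B := by
  ext i j
  simp [pair_apply]

lemma pair_neg_right : pair A (-B) = -pair A B := by
  ext i j
  simp [pair_apply]

lemma pair_zero_left : pair 0 B = 0 := by
  ext i j
  simp [pair_apply]

lemma pair_zero_right : pair A 0 = 0 := by
  ext i j
  simp [pair_apply]

lemma pair_smul_left (r : ℝ) : pair (r • A) B = r • pair A B := by
  ext i j
  simp [pair_apply, mul_assoc]

lemma pair_smul_right (r : ℝ) : pair A (r • B) = r • pair A B := by
  ext i j
  simp [pair_apply, mul_left_comm]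

lemma pair_mul_pair : pair A B * pair C D = pair (A * C) (B * D) := by
  rw [pair, pair, tensor_mul_tensor, pair]
  congr 1
  ext l : 1
  fin_cases l <;> rfl

lemma conjTranspose_pair : (pair A B)ᴴ = pair Aᴴ Bᴴ := by
  ext i j
  simp [pair_apply]

lemma partialTranspose_pair :
    partialTranspose (pair A B) = pair (partialTranspose A) (partialTranspose B) := by
  ext i j
  simp [pair_apply, partialTranspose]

lemma trace_pair : (pair A B).trace = A.trace * B.trace := by
  simp [pair, trace_tensor]

variable {A B} in
lemma pair_posSemidef (hA : A.PosSemidef) (hB : B.PosSemidef) : (pair A B).PosSemidef := by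
  refine tensor_posSemidef fun l => ?_
  fin_cases l
  exacts [hA, hB]

lemma ketBra_ketMul (u v w x : Fin 2 × Fin 2 → ℂ) :
    ketBra (ketMul u v) (ketMul w x) = pair (ketBra u w) (ketBra v x) := by
  ext i j
  simp [pair_apply, ketBra_apply, ketMul]
  ring

end Pair

/-! ### Block operators in the basis `ψ₀⁺, ψ₀⁻, ψ₁⁺, ψ₁⁻` -/

/-- The isometry with columns `ψ₀⁺, ψ₀⁻`. -/
def isom0 (θ : ℝ) : Matrix (Fin 2 × Fin 2) (Fin 2) ℂ :=
  Matrix.of fun i k => psi0 θ (k = 0) i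

/-- The isometry with columns `ψ₁⁺, ψ₁⁻`. -/
def isom1 (θ : ℝ) : Matrix (Fin 2 × Fin 2) (Fin 2) ℂ :=
  Matrix.of fun i k => psi1 θ (k = 0) i

/-- The operator with matrix `A` with respect to `ψ₀⁺, ψ₀⁻`, vanishing on `ψ₁⁺, ψ₁⁻`. -/
def block0 (θ : ℝ) (A : Matrix (Fin 2) (Fin 2) ℂ) : Matrix (Fin 2 × Fin 2) (Fin 2 × Fin 2) ℂ :=
  isom0 θ * A * (isom0 θ)ᴴ

/-- The operator with matrix `A` with respect to `ψ₁⁺, ψ₁⁻`, vanishing on `ψ₀⁺, ψ₀⁻`. -/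
def block1 (θ : ℝ) (A : Matrix (Fin 2) (Fin 2) ℂ) : Matrix (Fin 2 × Fin 2) (Fin 2 × Fin 2) ℂ :=
  isom1 θ * A * (isom1 θ)ᴴ

/-- The Pauli matrix `σ_z`. -/
def sigmaZ : Matrix (Fin 2) (Fin 2) ℂ := !![1, 0; 0, -1]

/-- The Pauli matrix `σ_x`. -/
def sigmaX : Matrix (Fin 2) (Fin 2) ℂ := !![0, 1; 1, 0]

/-- The real antisymmetric matrix `σ_z * σ_x = i σ_y`. -/
def sigmaW : Matrix (Fin 2) (Fin 2) ℂ := !![0, 1; -1, 0]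

lemma sigmaZ_mul_sigmaZ : sigmaZ * sigmaZ = 1 := by
  simp [sigmaZ, Matrix.one_fin_two]

lemma sigmaX_mul_sigmaX : sigmaX * sigmaX = 1 := by
  simp [sigmaX, Matrix.one_fin_two]

lemma sigmaW_mul_sigmaW : sigmaW * sigmaW = -1 := by
  simp [sigmaW, Matrix.one_fin_two]

lemma sigmaZ_mul_sigmaX : sigmaZ * sigmaX = sigmaW := by
  simp [sigmaZ, sigmaX, sigmaW]

lemma sigmaX_mul_sigmaZ : sigmaX * sigmaZ = -sigmaW := by
  simp [sigmaZ, sigmaX, sigmaW]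

lemma conjTranspose_sigmaZ : sigmaZᴴ = sigmaZ := by
  ext i j
  fin_cases i <;> fin_cases j <;> simp [sigmaZ]

lemma conjTranspose_sigmaX : sigmaXᴴ = sigmaX := by
  ext i j
  fin_cases i <;> fin_cases j <;> simp [sigmaX]

lemma conjTranspose_sigmaW : sigmaWᴴ = -sigmaW := by
  ext i j
  fin_cases i <;> fin_cases j <;> simp [sigmaW]

section Block

variable (θ : ℝ)

lemma cos_sq_add_sin_sq_cast : (Real.cos θ : ℂ) ^ 2 + (Real.sin θ : ℂ) ^ 2 = 1 := by
  exact_mod_cast Real.cos_sq_add_sin_sq θ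

lemma inv_sqrt_two_mul_self : ((√2 : ℝ) : ℂ)⁻¹ * ((√2 : ℝ) : ℂ)⁻¹ = 1 / 2 := by
  rw [← mul_inv, ← Complex.ofReal_mul, Real.mul_self_sqrt (by norm_num)]
  norm_num

lemma conjTranspose_isom0_mul_isom0 : (isom0 θ)ᴴ * isom0 θ = 1 := by
  have h := cos_sq_add_sin_sq_cast θ
  have h2 := inv_sqrt_two_mul_self
  generalize hc : Real.cos θ = c at *
  generalize hs : Real.sin θ = s at *
  ext i j
  fin_cases i <;> fin_cases j <;>
    simp [isom0, psi0, Matrix.mul_apply, Fintype.sum_prod_type, ket2, Pi.single_apply, hc, hs,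
      -Complex.ofReal_cos, -Complex.ofReal_sin] <;> grind

lemma conjTranspose_isom1_mul_isom1 : (isom1 θ)ᴴ * isom1 θ = 1 := by
  have h := cos_sq_add_sin_sq_cast θ
  have h2 := inv_sqrt_two_mul_self
  generalize hc : Real.cos θ = c at *
  generalize hs : Real.sin θ = s at *
  ext i j
  fin_cases i <;> fin_cases j <;>
    simp [isom1, psi1, Matrix.mul_apply, Fintype.sum_prod_type, ket2, Pi.single_apply, hc, hs,
      -Complex.ofReal_cos, -Complex.ofReal_sin] <;> grind

lemma conjTranspose_isom0_mul_isom1 : (isom0 θ)ᴴ * isom1 θ = 0 := by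
  have h := cos_sq_add_sin_sq_cast θ
  have h2 := inv_sqrt_two_mul_self
  generalize hc : Real.cos θ = c at *
  generalize hs : Real.sin θ = s at *
  ext i j
  fin_cases i <;> fin_cases j <;>
    simp [isom0, isom1, psi0, psi1, Matrix.mul_apply, Fintype.sum_prod_type, ket2, Pi.single_apply,
      hc, hs, -Complex.ofReal_cos, -Complex.ofReal_sin]
  all_goals grind

end Block

section Block

variable (θ : ℝ) (A B : Matrix (Fin 2) (Fin 2) ℂ)

lemma conjTranspose_isom1_mul_isom0 : (isom1 θ)ᴴ * isom0 θ = 0 := by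
  simpa using congrArg conjTranspose (conjTranspose_isom0_mul_isom1 θ)

lemma block0_mul_block0 : block0 θ A * block0 θ B = block0 θ (A * B) := by
  calc block0 θ A * block0 θ B = isom0 θ * A * ((isom0 θ)ᴴ * isom0 θ) * B * (isom0 θ)ᴴ := by
        simp only [block0, Matrix.mul_assoc]
    _ = _ := by
        rw [conjTranspose_isom0_mul_isom0, Matrix.mul_one, block0, Matrix.mul_assoc (isom0 θ)]

lemma block1_mul_block1 : block1 θ A * block1 θ B = block1 θ (A * B) := by
  calc block1 θ A * block1 θ B = isom1 θ * A * ((isom1 θ)ᴴ * isom1 θ) * B * (isom1 θ)ᴴ := by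
        simp only [block1, Matrix.mul_assoc]
    _ = _ := by
        rw [conjTranspose_isom1_mul_isom1, Matrix.mul_one, block1, Matrix.mul_assoc (isom1 θ)]

lemma block0_mul_block1 : block0 θ A * block1 θ B = 0 := by
  calc block0 θ A * block1 θ B = isom0 θ * A * ((isom0 θ)ᴴ * isom1 θ) * B * (isom1 θ)ᴴ := by
        simp only [block0, block1, Matrix.mul_assoc]
    _ = 0 := by rw [conjTranspose_isom0_mul_isom1]; simp

lemma block1_mul_block0 : block1 θ A * block0 θ B = 0 := by
  calc block1 θ A * block0 θ B = isom1 θ * A * ((isom1 θ)ᴴ * isom0 θ) * B * (isom0 θ)ᴴ := by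
        simp only [block0, block1, Matrix.mul_assoc]
    _ = 0 := by rw [conjTranspose_isom1_mul_isom0]; simp

lemma block0_neg : block0 θ (-A) = -block0 θ A := by simp [block0]

lemma conjTranspose_block0 : (block0 θ A)ᴴ = block0 θ Aᴴ := by
  simp [block0, Matrix.mul_assoc]

lemma conjTranspose_block1 : (block1 θ A)ᴴ = block1 θ Aᴴ := by
  simp [block1, Matrix.mul_assoc]

lemma trace_block0 : (block0 θ A).trace = A.trace := by
  rw [block0, Matrix.mul_assoc, trace_mul_comm, Matrix.mul_assoc, conjTranspose_isom0_mul_isom0,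
    Matrix.mul_one]

lemma trace_block1 : (block1 θ A).trace = A.trace := by
  rw [block1, Matrix.mul_assoc, trace_mul_comm, Matrix.mul_assoc, conjTranspose_isom1_mul_isom1,
    Matrix.mul_one]

lemma block0_one_posSemidef : (block0 θ 1).PosSemidef := by
  simpa [block0] using posSemidef_self_mul_conjTranspose (isom0 θ)

lemma block1_one_posSemidef : (block1 θ 1).PosSemidef := by
  simpa [block1] using posSemidef_self_mul_conjTranspose (isom1 θ)

lemma block0_sigmaZ : block0 θ sigmaZ =
    ketBra (psi0 θ true) (psi0 θ true) - ketBra (psi0 θ false) (psi0 θ false) := by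
  ext i j
  simp [block0, isom0, Matrix.mul_apply, Fin.sum_univ_two, sigmaZ, ketBra_apply]
  ring

lemma block0_sigmaX : block0 θ sigmaX =
    ketBra (psi0 θ true) (psi0 θ false) + ketBra (psi0 θ false) (psi0 θ true) := by
  ext i j
  simp [block0, isom0, Matrix.mul_apply, Fin.sum_univ_two, sigmaX, ketBra_apply]
  ring

lemma block1_sigmaZ : block1 θ sigmaZ =
    ketBra (psi1 θ true) (psi1 θ true) - ketBra (psi1 θ false) (psi1 θ false) := by
  ext i j
  simp [block1, isom1, Matrix.mul_apply, Fin.sum_univ_two, sigmaZ, ketBra_apply]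
  ring

lemma block0_one_add_block1_one : block0 θ 1 + block1 θ 1 = 1 := by
  have h := cos_sq_add_sin_sq_cast θ
  have h2 := inv_sqrt_two_mul_self
  generalize hc : Real.cos θ = c at *
  generalize hs : Real.sin θ = s at *
  ext ⟨i, i'⟩ ⟨j, j'⟩
  fin_cases i <;> fin_cases i' <;> fin_cases j <;> fin_cases j' <;>
    simp [block0, block1, isom0, isom1, psi0, psi1, Matrix.mul_apply, Fin.sum_univ_two, ket2,
      hc, hs, -Complex.ofReal_cos, -Complex.ofReal_sin]
  all_goals grind

lemma partialTranspose_block0_sigmaX :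
    partialTranspose (block0 θ sigmaX) = block0 θ sigmaX := by
  have h2 := inv_sqrt_two_mul_self
  rw [block0_sigmaX]
  generalize hc : Real.cos θ = c at *
  generalize hs : Real.sin θ = s at *
  ext ⟨i, i'⟩ ⟨j, j'⟩
  fin_cases i <;> fin_cases i' <;> fin_cases j <;> fin_cases j' <;>
    simp [partialTranspose, ketBra_apply, psi0, ket2,
      Pi.single_apply, hc, hs, -Complex.ofReal_cos, -Complex.ofReal_sin]
  all_goals grind

lemma partialTranspose_block0_sigmaZ :
    partialTranspose (block0 θ sigmaZ) = -block1 θ sigmaZ := by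
  have h := cos_sq_add_sin_sq_cast θ
  have h2 := inv_sqrt_two_mul_self
  rw [block0_sigmaZ, block1_sigmaZ]
  generalize hc : Real.cos θ = c at *
  generalize hs : Real.sin θ = s at *
  ext ⟨i, i'⟩ ⟨j, j'⟩
  fin_cases i <;> fin_cases i' <;> fin_cases j <;> fin_cases j' <;>
    simp [partialTranspose, ketBra_apply, psi0, psi1, ket2,
      Pi.single_apply, hc, hs, -Complex.ofReal_cos, -Complex.ofReal_sin]
  all_goals grind

lemma partialTranspose_block1_sigmaZ :
    partialTranspose (block1 θ sigmaZ) = -block0 θ sigmaZ := by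
  rw [← neg_neg (block1 θ sigmaZ), ← partialTranspose_block0_sigmaZ]
  rfl

lemma trace_sigmaW : sigmaW.trace = 0 := by simp [sigmaW, Matrix.trace_fin_two]

/-! ### The two-qubit ensemble -/

/-- The operator `η₀ρ₀ - η₁ρ₁` in the basis `ψ₀⁺, ψ₀⁻, ψ₁⁺, ψ₁⁻`. -/
lemma lam_exState : lam exProb (exState θ) =
    (1 / 4 : ℝ) • ((2 * Real.cos θ) • block0 θ sigmaX -
      (1 - Real.cos θ ^ 2) • (block0 θ sigmaZ - block1 θ sigmaZ)) := by
  have h := cos_sq_add_sin_sq_cast θ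
  have h2 := inv_sqrt_two_mul_self
  rw [block0_sigmaZ, block1_sigmaZ, block0_sigmaX]
  generalize hc : Real.cos θ = c at *
  generalize hs : Real.sin θ = s at *
  ext ⟨i, i'⟩ ⟨j, j'⟩
  fin_cases i <;> fin_cases i' <;> fin_cases j <;> fin_cases j' <;>
    simp [lam, exProb, exState, ketPlus, ketMinus, ket0, ket1, ketBra_apply, psi0, psi1, ket2,
      hc, hs, -Complex.ofReal_cos, -Complex.ofReal_sin]
  all_goals grind

lemma partialTranspose_lam_exState :
    partialTranspose (lam exProb (exState θ)) = lam exProb (exState θ) := by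
  rw [lam_exState]
  simp only [partialTranspose_smul, partialTranspose_sub, partialTranspose_block0_sigmaX,
    partialTranspose_block0_sigmaZ, partialTranspose_block1_sigmaZ]
  module

lemma isState_ketBra {v : Fin 2 → ℂ} (h : v ⬝ᵥ star v = 1) : IsState (ketBra v v) :=
  ⟨ketBra_posSemidef v, by rw [ketBra, trace_vecMulVec, h]⟩

lemma isState_ket0 : IsState (ketBra ket0 ket0) :=
  isState_ketBra (by simp [ket0, dotProduct, Fin.sum_univ_two])

lemma isState_ket1 : IsState (ketBra ket1 ket1) :=
  isState_ketBra (by simp [ket1, dotProduct, Fin.sum_univ_two])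

lemma isState_ketPlus : IsState (ketBra (ketPlus θ) (ketPlus θ)) := by
  have h := cos_sq_add_sin_sq_cast θ
  refine isState_ketBra ?_
  simp [ketPlus, ket0, ket1, dotProduct, Fin.sum_univ_two, -Complex.ofReal_cos,
    -Complex.ofReal_sin]
  linear_combination h

lemma isState_ketMinus : IsState (ketBra (ketMinus θ) (ketMinus θ)) := by
  have h := cos_sq_add_sin_sq_cast θ
  refine isState_ketBra ?_
  simp [ketMinus, ket0, ket1, dotProduct, Fin.sum_univ_two, -Complex.ofReal_cos,
    -Complex.ofReal_sin]
  linear_combination h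

/-- An equal mixture of two product states is a separable state. -/
lemma isState_and_isSeparableState_mix {σ σ' τ τ' : Matrix (Fin 2) (Fin 2) ℂ} (hσ : IsState σ)
    (hσ' : IsState σ') (hτ : IsState τ) (hτ' : IsState τ') :
    IsState ((1 / 2 : ℝ) • (σ ⊗ₖ τ) + (1 / 2 : ℝ) • (σ' ⊗ₖ τ')) ∧
      IsSeparableState ((1 / 2 : ℝ) • (σ ⊗ₖ τ) + (1 / 2 : ℝ) • (σ' ⊗ₖ τ')) := by
  refine ⟨⟨?_, ?_⟩, 2, fun _ => 1 / 2, ![σ, σ'], ![τ, τ'], ?_, ?_, ?_, ?_, ?_⟩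
  · exact (real_smul_posSemidef (hσ.1.kronecker hτ.1) (by norm_num)).add
      (real_smul_posSemidef (hσ'.1.kronecker hτ'.1) (by norm_num))
  · rw [trace_add, trace_smul, trace_smul, trace_kronecker, trace_kronecker, hσ.2, hσ'.2, hτ.2,
      hτ'.2]
    norm_num
  · norm_num
  · norm_num
  · simp [Fin.forall_fin_two, hσ, hσ']
  · simp [Fin.forall_fin_two, hτ, hτ']
  · simp [Fin.sum_univ_two]

lemma isState_and_isSeparableState_exState (i : ZMod 2) :
    IsState (exState θ i) ∧ IsSeparableState (exState θ i) := by
  rw [exState]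
  split_ifs
  · exact isState_and_isSeparableState_mix isState_ket0 (isState_ketPlus θ) (isState_ketPlus θ)
      isState_ket0
  · exact isState_and_isSeparableState_mix isState_ket1 (isState_ketMinus θ) isState_ket1
      (isState_ketMinus θ)

lemma exState_mul_exState : exState θ 0 * exState θ 1 = 0 := by
  have h0 : ketBra ket0 ket0 * ketBra ket1 ket1 = 0 :=
    ketBra_mul_ketBra_of_orthogonal (by simp [ket0, ket1, dotProduct, Fin.sum_univ_two])
  have h1 : ketBra (ketPlus θ) (ketPlus θ) * ketBra (ketMinus θ) (ketMinus θ) = 0 := by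
    refine ketBra_mul_ketBra_of_orthogonal ?_
    simp [ketPlus, ketMinus, ket0, ket1, dotProduct, Fin.sum_univ_two, -Complex.ofReal_cos,
      -Complex.ofReal_sin]
    ring
  simp [exState, Matrix.add_mul, Matrix.mul_add, ← mul_kronecker_mul, h0, h1]

/-- The observable `T` with values `±1` that identifies the states of the ensemble: it satisfies
`Λ T = |Λ|` for `Λ = η₀ρ₀ - η₁ρ₁`. -/
def signObs : Matrix (Fin 2 × Fin 2) (Fin 2 × Fin 2) ℂ :=
  (1 / (1 + Real.cos θ ^ 2)) • ((2 * Real.cos θ) • block0 θ sigmaX -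
    (1 - Real.cos θ ^ 2) • block0 θ sigmaZ) + block1 θ sigmaZ

lemma signObs_isHermitian : (signObs θ).IsHermitian := by
  simp [IsHermitian, signObs, conjTranspose_block0, conjTranspose_block1, conjTranspose_sigmaX,
    conjTranspose_sigmaZ]

lemma signObs_mul_signObs : signObs θ * signObs θ = 1 := by
  have hn : 1 + Real.cos θ ^ 2 ≠ 0 := by positivity
  rw [← block0_one_add_block1_one θ, signObs]
  simp only [Matrix.add_mul, Matrix.mul_add, Matrix.sub_mul, Matrix.mul_sub, Matrix.smul_mul,
    Matrix.mul_smul, block0_mul_block0, block0_mul_block1, block1_mul_block0, block1_mul_block1,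
    sigmaZ_mul_sigmaZ, sigmaX_mul_sigmaX, sigmaZ_mul_sigmaX, sigmaX_mul_sigmaZ, block0_neg]
  match_scalars <;> field_simp <;> ring

lemma trace_lam_mul_signObs : (lam exProb (exState θ) * signObs θ).trace = 1 := by
  have hn : (1 + Real.cos θ ^ 2 : ℂ) ≠ 0 := by
    have : 1 + Real.cos θ ^ 2 ≠ 0 := by positivity
    exact_mod_cast this
  rw [lam_exState, signObs]
  simp only [Matrix.mul_add, Matrix.sub_mul, Matrix.mul_sub, Matrix.smul_mul,
    Matrix.mul_smul, block0_mul_block0, block0_mul_block1, block1_mul_block0, block1_mul_block1,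
    sigmaZ_mul_sigmaZ, sigmaX_mul_sigmaX, sigmaZ_mul_sigmaX, sigmaX_mul_sigmaZ, block0_neg,
    trace_add, trace_sub, trace_smul, trace_neg, trace_zero, trace_block0, trace_block1,
    trace_sigmaW, trace_one, Fintype.card_fin, Complex.real_smul]
  push_cast [-Complex.ofReal_cos]
  field_simp
  ring

end Block

section Decomposition

variable (θ : ℝ)

/-! ### The operator `H` and its partial transpose -/

lemma ketBra_inv_sqrt_two_smul {n : Type} (u v : n → ℂ) :
    ketBra ((1 / √2) • u) ((1 / √2) • v) = (1 / 2 : ℝ) • ketBra u v := by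
  rw [ketBra_smul_left, ketBra_smul_right, smul_smul, div_mul_div_comm,
    Real.mul_self_sqrt (by norm_num), one_mul]

lemma diagPart_zero : diagPart θ 0 = (1 / 2 : ℝ) •
    (pair (block0 θ sigmaZ) (block0 θ sigmaZ) - pair (block0 θ sigmaX) (block0 θ sigmaX)) := by
  simp only [diagPart, bigPsi, block0_sigmaZ, block0_sigmaX, sgn, Matrix.cons_val, Bool.not_true,
    Bool.not_false, if_true, Bool.false_eq_true, if_false, one_smul, neg_smul, sub_neg_eq_add,
    ← sub_eq_add_neg, ketBra_inv_sqrt_two_smul, ketBra_add_left, ketBra_add_right,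
    ketBra_sub_left, ketBra_sub_right, ketBra_ketMul, pair_add_left,
    pair_add_right, pair_sub_left, pair_sub_right]
  module

lemma diagPart_one : diagPart θ 1 = (1 / 2 : ℝ) •
    (pair (block0 θ sigmaZ) (block0 θ sigmaZ) + pair (block0 θ sigmaX) (block0 θ sigmaX)) := by
  simp only [diagPart, bigPsi, block0_sigmaZ, block0_sigmaX, sgn, Matrix.cons_val, Bool.not_true,
    Bool.not_false, if_true, Bool.false_eq_true, if_false, one_smul, neg_smul, sub_neg_eq_add,
    ← sub_eq_add_neg, ketBra_inv_sqrt_two_smul, ketBra_add_left, ketBra_add_right,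
    ketBra_sub_left, ketBra_sub_right, ketBra_ketMul, pair_add_left,
    pair_add_right, pair_sub_left, pair_sub_right]
  module

lemma offDiag_bigPsi_zero :
    ketBra (bigPsi θ 0 true) (bigPsi θ 0 false) + ketBra (bigPsi θ 0 false) (bigPsi θ 0 true) =
      (1 / 2 : ℝ) • (pair (block0 θ sigmaZ) (block0 θ sigmaX) +
        pair (block0 θ sigmaX) (block0 θ sigmaZ)) := by
  simp only [bigPsi, block0_sigmaZ, block0_sigmaX, sgn, Matrix.cons_val, Bool.not_true,
    Bool.not_false, if_true, Bool.false_eq_true, if_false, one_smul, neg_smul, sub_neg_eq_add,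
    ← sub_eq_add_neg, ketBra_inv_sqrt_two_smul, ketBra_add_left, ketBra_add_right,
    ketBra_sub_left, ketBra_sub_right, ketBra_ketMul, pair_add_left,
    pair_add_right, pair_sub_left, pair_sub_right]
  module

/-- The difference of the projections onto `φ⁺` and `φ⁻`, where `φ⁺ = phiA θ true` and
`φ⁻ = phiA θ false`. -/
lemma ketBra_phiA_sub : ketBra (phiA θ true) (phiA θ true) - ketBra (phiA θ false) (phiA θ false) =
    (1 / (1 + Real.cos θ ^ 2)) • ((2 * Real.cos θ) • block0 θ sigmaX -
      (1 - Real.cos θ ^ 2) • block0 θ sigmaZ) := by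
  have hr : √(1 + Real.cos θ ^ 2) ^ 2 = 1 + Real.cos θ ^ 2 := Real.sq_sqrt (by positivity)
  simp only [phiA, block0_sigmaZ, block0_sigmaX, sgn, Bool.not_true, Bool.not_false, if_true,
    Bool.false_eq_true, if_false, ketBra_add_left, ketBra_add_right, ketBra_smul_left,
    ketBra_smul_right]
  have hn : √(1 + Real.cos θ ^ 2) ≠ 0 := by positivity
  generalize √(1 + Real.cos θ ^ 2) = n at hr hn ⊢
  rw [← hr]
  match_scalars <;> field_simp <;> ring

lemma ketBra_phiB_sub : ketBra (phiB θ true) (phiB θ true) - ketBra (phiB θ false) (phiB θ false) =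
    -(ketBra (phiA θ true) (phiA θ true) - ketBra (phiA θ false) (phiA θ false)) := by
  simp only [phiA, phiB, sgn, Bool.not_true, Bool.not_false, if_true,
    Bool.false_eq_true, if_false, ketBra_add_left, ketBra_add_right, ketBra_sub_left,
    ketBra_sub_right, ketBra_smul_left, ketBra_smul_right]
  module

lemma diagPart_sum : diagPart θ 4 + diagPart θ 5 + diagPart θ 6 + diagPart θ 7 =
    (1 / (1 + Real.cos θ ^ 2)) • ((2 * Real.cos θ) • (pair (block0 θ sigmaX) (block1 θ sigmaZ) +
        pair (block1 θ sigmaZ) (block0 θ sigmaX)) -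
      (1 - Real.cos θ ^ 2) • (pair (block0 θ sigmaZ) (block1 θ sigmaZ) +
        pair (block1 θ sigmaZ) (block0 θ sigmaZ))) := by
  have hA := ketBra_phiA_sub θ
  have hB := ketBra_phiB_sub θ
  rw [hA] at hB
  have h : diagPart θ 4 + diagPart θ 5 + diagPart θ 6 + diagPart θ 7 =
      pair (ketBra (phiA θ true) (phiA θ true) - ketBra (phiA θ false) (phiA θ false))
          (ketBra (psi1 θ true) (psi1 θ true)) +
        pair (ketBra (phiB θ true) (phiB θ true) - ketBra (phiB θ false) (phiB θ false))
          (ketBra (psi1 θ false) (psi1 θ false)) +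
        pair (ketBra (psi1 θ true) (psi1 θ true))
          (ketBra (phiA θ true) (phiA θ true) - ketBra (phiA θ false) (phiA θ false)) +
        pair (ketBra (psi1 θ false) (psi1 θ false))
          (ketBra (phiB θ true) (phiB θ true) - ketBra (phiB θ false) (phiB θ false)) := by
    simp only [diagPart, bigPsi, Matrix.cons_val, ketBra_ketMul, pair_sub_left, pair_sub_right]
  rw [h, hA, hB, block1_sigmaZ]
  simp only [pair_smul_left, pair_smul_right, pair_sub_left, pair_sub_right, pair_neg_left,
    pair_neg_right]
  module

/-- The operator `H` in terms of tensor products of Pauli matrices. -/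
lemma exH_eq : exH θ = (1 / 16 : ℝ) •
    ((1 - Real.cos θ ^ 2) ^ 2 • pair (block0 θ sigmaZ) (block0 θ sigmaZ) +
      (2 * Real.cos θ ^ 2) • pair (block0 θ sigmaX) (block0 θ sigmaX) -
      (Real.cos θ * (1 - Real.cos θ ^ 2)) • (pair (block0 θ sigmaZ) (block0 θ sigmaX) +
        pair (block0 θ sigmaX) (block0 θ sigmaZ)) -
      ((1 - Real.cos θ ^ 2) ^ 2 / 2) • (pair (block0 θ sigmaZ) (block1 θ sigmaZ) +
        pair (block1 θ sigmaZ) (block0 θ sigmaZ)) +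
      (Real.cos θ * (1 - Real.cos θ ^ 2)) • (pair (block0 θ sigmaX) (block1 θ sigmaZ) +
        pair (block1 θ sigmaZ) (block0 θ sigmaX))) := by
  have hn : 1 + Real.cos θ ^ 2 ≠ 0 := by positivity
  have h4 : Real.sin θ ^ 4 = (1 - Real.cos θ ^ 2) ^ 2 := by
    rw [← Real.sin_sq]
    ring
  rw [exH, diagPart_zero, diagPart_one, offDiag_bigPsi_zero, diagPart_sum, h4, Real.sin_sq]
  match_scalars <;> field_simp <;> ring

lemma partialTranspose_exH_eq : partialTranspose (exH θ) = (1 / 16 : ℝ) •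
    ((1 - Real.cos θ ^ 2) ^ 2 • pair (block1 θ sigmaZ) (block1 θ sigmaZ) +
      (2 * Real.cos θ ^ 2) • pair (block0 θ sigmaX) (block0 θ sigmaX) +
      (Real.cos θ * (1 - Real.cos θ ^ 2)) • (pair (block1 θ sigmaZ) (block0 θ sigmaX) +
        pair (block0 θ sigmaX) (block1 θ sigmaZ)) -
      ((1 - Real.cos θ ^ 2) ^ 2 / 2) • (pair (block1 θ sigmaZ) (block0 θ sigmaZ) +
        pair (block0 θ sigmaZ) (block1 θ sigmaZ)) -
      (Real.cos θ * (1 - Real.cos θ ^ 2)) • (pair (block0 θ sigmaX) (block0 θ sigmaZ) +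
        pair (block0 θ sigmaZ) (block0 θ sigmaX))) := by
  rw [exH_eq]
  simp only [partialTranspose_smul, partialTranspose_sub, partialTranspose_add,
    partialTranspose_pair, partialTranspose_block0_sigmaX, partialTranspose_block0_sigmaZ,
    partialTranspose_block1_sigmaZ, pair_neg_left, pair_neg_right]
  module

lemma exH_isHermitian : (exH θ).IsHermitian := by
  rw [exH_eq]
  simp [IsHermitian, conjTranspose_pair, conjTranspose_block0, conjTranspose_block1,
    conjTranspose_sigmaX, conjTranspose_sigmaZ]

lemma exH_add_partialTranspose :
    exH θ + partialTranspose (exH θ) = tensor (fun _ : Fin 2 => lam exProb (exState θ)) := by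
  rw [tensor_two, partialTranspose_exH_eq, exH_eq, lam_exState]
  simp only [pair_smul_left, pair_smul_right, pair_sub_left, pair_sub_right]
  module

/-! ### The trace norms of `H` and its partial transpose -/

/-- On the tensor square of the span of `ψ₀⁺, ψ₀⁻`, both `H²` and `(H^Γ)²` are combinations of the
projections `(I ⊗ I ± W ⊗ W) / 2`. -/
lemma pair_proj_posSemidef {r : ℝ} (hr : r * r = 1) :
    ((1 / 2 : ℝ) • (pair (block0 θ 1) (block0 θ 1) +
      r • pair (block0 θ sigmaW) (block0 θ sigmaW))).PosSemidef := by
  refine isStarProjection_posSemidef ?_ ?_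
  · simp [IsHermitian, conjTranspose_pair, conjTranspose_block0, conjTranspose_sigmaW, block0_neg,
      pair_neg_left, pair_neg_right]
  · simp only [Matrix.smul_mul, Matrix.mul_smul, Matrix.add_mul, Matrix.mul_add, pair_mul_pair,
      block0_mul_block0, sigmaW_mul_sigmaW, Matrix.one_mul, Matrix.mul_one, block0_neg,
      pair_neg_left, pair_neg_right]
    match_scalars
    · linear_combination (1 / 4) * hr
    · ring

/-- The combination, with coefficients `a, b, d, e`, of four orthogonal projections of ranks
`2, 2, 8, 4` adding up to the identity; `|H|` and `|H^Γ|` are of this form. -/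
def absForm (a b d e : ℝ) :
    Matrix ((Fin 2 → Fin 2) × (Fin 2 → Fin 2)) ((Fin 2 → Fin 2) × (Fin 2 → Fin 2)) ℂ :=
  a • ((1 / 2 : ℝ) • (pair (block0 θ 1) (block0 θ 1) +
      (1 : ℝ) • pair (block0 θ sigmaW) (block0 θ sigmaW))) +
    b • ((1 / 2 : ℝ) • (pair (block0 θ 1) (block0 θ 1) +
      (-1 : ℝ) • pair (block0 θ sigmaW) (block0 θ sigmaW))) +
    d • (pair (block0 θ 1) (block1 θ 1) + pair (block1 θ 1) (block0 θ 1)) +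
    e • pair (block1 θ 1) (block1 θ 1)

lemma absForm_posSemidef {a b d e : ℝ} (ha : 0 ≤ a) (hb : 0 ≤ b) (hd : 0 ≤ d) (he : 0 ≤ e) :
    (absForm θ a b d e).PosSemidef := by
  have h0 := block0_one_posSemidef θ
  have h1 := block1_one_posSemidef θ
  exact (((real_smul_posSemidef (pair_proj_posSemidef θ (by norm_num)) ha).add
    (real_smul_posSemidef (pair_proj_posSemidef θ (by norm_num)) hb)).add
    (real_smul_posSemidef ((pair_posSemidef h0 h1).add (pair_posSemidef h1 h0)) hd)).add
    (real_smul_posSemidef (pair_posSemidef h1 h1) he)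

lemma trace_absForm (a b d e : ℝ) :
    (absForm θ a b d e).trace.re = 2 * a + 2 * b + 8 * d + 4 * e := by
  simp [absForm, trace_pair, trace_block0, trace_block1, trace_sigmaW]
  ring

lemma absForm_mul_absForm (a b d e : ℝ) :
    absForm θ a b d e * absForm θ a b d e = absForm θ (a ^ 2) (b ^ 2) (d ^ 2) (e ^ 2) := by
  simp only [absForm, Matrix.smul_mul, Matrix.mul_smul, Matrix.add_mul, Matrix.mul_add,
    pair_mul_pair, block0_mul_block0, block0_mul_block1, block1_mul_block0, block1_mul_block1,
    sigmaW_mul_sigmaW, Matrix.one_mul, Matrix.mul_one, block0_neg, pair_neg_left, pair_neg_right,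
    pair_zero_left, pair_zero_right]
  module

lemma exH_mul_exH : exH θ * exH θ = absForm θ (((1 + Real.cos θ ^ 4) / 16) ^ 2)
    ((4 * Real.cos θ ^ 4 + Real.sin θ ^ 8) / 16 ^ 2) (((1 - Real.cos θ ^ 4) / 32) ^ 2) 0 := by
  have h8 : Real.sin θ ^ 8 = (1 - Real.cos θ ^ 2) ^ 4 := by
    rw [← Real.sin_sq]
    ring
  rw [exH_eq, h8, absForm]
  simp only [Matrix.smul_mul, Matrix.mul_smul, Matrix.add_mul, Matrix.mul_add, Matrix.sub_mul,
    Matrix.mul_sub, pair_mul_pair, block0_mul_block0, block0_mul_block1, block1_mul_block0,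
    block1_mul_block1, sigmaZ_mul_sigmaZ, sigmaX_mul_sigmaX, sigmaZ_mul_sigmaX, sigmaX_mul_sigmaZ,
    block0_neg, pair_neg_left, pair_neg_right, pair_zero_left, pair_zero_right]
  module

lemma partialTranspose_exH_mul_self :
    partialTranspose (exH θ) * partialTranspose (exH θ) =
      absForm θ ((Real.cos θ ^ 2 / 8) ^ 2)
        (Real.cos θ ^ 2 * (Real.cos θ ^ 2 + Real.sin θ ^ 4) / 8 ^ 2)
        (((1 - Real.cos θ ^ 4) / 32) ^ 2) ((Real.sin θ ^ 4 / 16) ^ 2) := by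
  have h4 : Real.sin θ ^ 4 = (1 - Real.cos θ ^ 2) ^ 2 := by
    rw [← Real.sin_sq]
    ring
  rw [partialTranspose_exH_eq, h4, absForm]
  simp only [Matrix.smul_mul, Matrix.mul_smul, Matrix.add_mul, Matrix.mul_add, Matrix.sub_mul,
    Matrix.mul_sub, pair_mul_pair, block0_mul_block0, block0_mul_block1, block1_mul_block0,
    block1_mul_block1, sigmaZ_mul_sigmaZ, sigmaX_mul_sigmaX, sigmaZ_mul_sigmaX, sigmaX_mul_sigmaZ,
    block0_neg, pair_neg_left, pair_neg_right, pair_zero_left, pair_zero_right]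
  module

lemma cos_pow_four_le_one : Real.cos θ ^ 4 ≤ 1 := by
  have h := Real.cos_sq_le_one θ
  calc Real.cos θ ^ 4 = (Real.cos θ ^ 2) ^ 2 := by ring
    _ ≤ 1 := pow_le_one₀ (sq_nonneg _) h

lemma traceNorm_exH : traceNorm (exH θ) = f0 θ := by
  have h := absForm_mul_absForm θ ((1 + Real.cos θ ^ 4) / 16)
    (√(4 * Real.cos θ ^ 4 + Real.sin θ ^ 8) / 16) ((1 - Real.cos θ ^ 4) / 32) 0
  rw [div_pow √_, Real.sq_sqrt (by positivity), zero_pow two_ne_zero, ← exH_mul_exH] at h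
  have hc := cos_pow_four_le_one θ
  rw [traceNorm_eq_of_mul_self (absForm_posSemidef θ (by positivity) (by positivity)
    (by linarith) le_rfl) (h.trans (by rw [(exH_isHermitian θ).eq])), trace_absForm, f0]
  ring

lemma traceNorm_partialTranspose_exH (hc : 0 ≤ Real.cos θ) :
    traceNorm (partialTranspose (exH θ)) = f1 θ := by
  have h := absForm_mul_absForm θ (Real.cos θ ^ 2 / 8)
    (Real.cos θ * √(Real.cos θ ^ 2 + Real.sin θ ^ 4) / 8) ((1 - Real.cos θ ^ 4) / 32)
    (Real.sin θ ^ 4 / 16)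
  rw [div_pow (_ * √_), mul_pow, Real.sq_sqrt (by positivity), ← partialTranspose_exH_mul_self] at h
  have hc' := cos_pow_four_le_one θ
  rw [traceNorm_eq_of_mul_self (absForm_posSemidef θ (by positivity) (by positivity)
    (by linarith) (by positivity))
    (h.trans (by rw [(partialTranspose_isHermitian (exH_isHermitian θ)).eq])), trace_absForm, f1]
  have h4 : Real.sin θ ^ 4 = (1 - Real.cos θ ^ 2) ^ 2 := by
    rw [← Real.sin_sq]
    ring
  linear_combination (1 / 4) * h4 - (1 / 4) * Real.sin_sq_add_cos_sq θ

lemma f0_pos : 0 < f0 θ := by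
  have := cos_pow_four_le_one θ
  have := Real.sqrt_nonneg (4 * Real.cos θ ^ 4 + Real.sin θ ^ 8)
  rw [f0]
  linarith

lemma f1_pos (hc : 0 ≤ Real.cos θ) : 0 < f1 θ := by
  rw [f1]
  positivity

/-! ### The angles `π / 6` and `π / 4` -/

lemma four_mul_f0_mul_f1_pi_div_six :
    4 * f0 (Real.pi / 6) * f1 (Real.pi / 6) = (39 + √577) * (10 + √39) / 1024 := by
  have h4 : √3 ^ 4 = 9 := by
    rw [show √3 ^ 4 = (√3 ^ 2) ^ 2 by ring, Real.sq_sqrt (by norm_num)]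
    norm_num
  have h1 : √(4 * (√3 / 2) ^ 4 + (1 / 2) ^ 8) = √577 / 16 := by
    rw [div_pow, h4, show (4 : ℝ) * (9 / 2 ^ 4) + (1 / 2) ^ 8 = 577 / 16 ^ 2 by norm_num,
      Real.sqrt_div (by norm_num), Real.sqrt_sq (by norm_num)]
  have h2 : √3 / 2 * √((√3 / 2) ^ 2 + (1 / 2) ^ 4) = √39 / 8 := by
    rw [div_pow, Real.sq_sqrt (by norm_num), show (3 : ℝ) / 2 ^ 2 + (1 / 2) ^ 4 = 13 / 4 ^ 2 by
      norm_num, Real.sqrt_div (by norm_num), Real.sqrt_sq (by norm_num),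
      show (39 : ℝ) = 3 * 13 by norm_num, Real.sqrt_mul (by norm_num)]
    ring
  rw [f0, f1, Real.cos_pi_div_six, Real.sin_pi_div_six, h1, h2, div_pow √3 2 4, h4]
  ring

lemma four_mul_f0_mul_f1_pi_div_four :
    4 * f0 (Real.pi / 4) * f1 (Real.pi / 4) = (11 + √17) * (6 + √6) / 128 := by
  have h2 : √2 ^ 2 = 2 := Real.sq_sqrt (by norm_num)
  have h4 : √2 ^ 4 = 4 := by
    rw [show √2 ^ 4 = (√2 ^ 2) ^ 2 by ring, h2]
    norm_num
  have h8 : √2 ^ 8 = 16 := by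
    rw [show √2 ^ 8 = (√2 ^ 2) ^ 4 by ring, h2]
    norm_num
  have e1 : √(4 * (√2 / 2) ^ 4 + (√2 / 2) ^ 8) = √17 / 4 := by
    rw [div_pow, div_pow, h4, h8, show (4 : ℝ) * (4 / 2 ^ 4) + 16 / 2 ^ 8 = 17 / 4 ^ 2 by norm_num,
      Real.sqrt_div (by norm_num), Real.sqrt_sq (by norm_num)]
  have e2 : √2 / 2 * √((√2 / 2) ^ 2 + (√2 / 2) ^ 4) = √6 / 4 := by
    rw [div_pow, div_pow, h2, h4, show (2 : ℝ) / 2 ^ 2 + 4 / 2 ^ 4 = 3 / 2 ^ 2 by norm_num,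
      Real.sqrt_div (by norm_num), Real.sqrt_sq (by norm_num),
      show (6 : ℝ) = 2 * 3 by norm_num, Real.sqrt_mul (by norm_num)]
    ring
  rw [f0, f1, Real.cos_pi_div_four, Real.sin_pi_div_four, e1, e2, div_pow √2 2 4, div_pow √2 2 2,
    h4, h2]
  ring

lemma value_pi_div_six_bounds :
    0.99977 < (39 + √577) * (10 + √39) / 1024 ∧ (39 + √577) * (10 + √39) / 1024 < 0.99979 := by
  have a1 : 24.0208 < √577 := Real.lt_sqrt_of_sq_lt (by norm_num)
  have a2 : √577 < 24.0209 := (Real.sqrt_lt' (by norm_num)).mpr (by norm_num)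
  have b1 : 6.2449 < √39 := Real.lt_sqrt_of_sq_lt (by norm_num)
  have b2 : √39 < 6.245 := (Real.sqrt_lt' (by norm_num)).mpr (by norm_num)
  constructor <;> nlinarith

lemma value_pi_div_four_bounds :
    0.99829 < (11 + √17) * (6 + √6) / 128 ∧ (11 + √17) * (6 + √6) / 128 < 0.99831 := by
  have a1 : 4.1231 < √17 := Real.lt_sqrt_of_sq_lt (by norm_num)
  have a2 : √17 < 4.12311 := (Real.sqrt_lt' (by norm_num)).mpr (by norm_num)
  have b1 : 2.44948 < √6 := Real.lt_sqrt_of_sq_lt (by norm_num)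
  have b2 : √6 < 2.4495 := (Real.sqrt_lt' (by norm_num)).mpr (by norm_num)
  constructor <;> nlinarith

end Decomposition

lemma exProb_nonneg (i : ZMod 2) : 0 ≤ exProb i := by
  norm_num [exProb]

lemma sum_exProb : ∑ i, exProb i = 1 := by
  rw [zmod_two_sum]
  norm_num [exProb]

end DataHiding

end

open DataHiding
theorem mainTheorem3 :
    (∀ θ : ℝ, 0 ≤ θ → θ ≤ Real.pi / 3 →
      -- two orthogonal separable two-qubit states
      (∀ i, IsState (exState θ i) ∧ IsSeparableState (exState θ i)) ∧
      exState θ 0 * exState θ 1 = 0 ∧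
      -- invariance under partial transposition
      partialTranspose (lam exProb (exState θ)) = lam exProb (exState θ) ∧
      -- the explicit decomposition of the second tensor power, and the trace norms
      (exH θ).IsHermitian ∧
      exH θ + partialTranspose (exH θ) = tensor (fun _ : Fin 2 => lam exProb (exState θ)) ∧
      traceNorm (exH θ) = f0 θ ∧
      traceNorm (partialTranspose (exH θ)) = f1 θ ∧
      -- perfect global discrimination, and the order of the guessing probabilities
      (∀ L : ℕ, 1 ≤ L →
        pG (probPar exProb L) (statePar exProb (exState θ) L) = 1 ∧
        1 / 2 ≤ pL (probPar exProb L) (statePar exProb (exState θ) L) ∧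
        pL (probPar exProb L) (statePar exProb (exState θ) L) ≤
          pPPT (probPar exProb L) (statePar exProb (exState θ) L)) ∧
      -- the bound and its consequences
      (4 * f0 θ * f1 θ < 1 →
        (∀ L : ℕ, 1 ≤ L →
          pPPT (probPar exProb L) (statePar exProb (exState θ) L) ≤
            1 / 2 + 1 / 2 * (4 * f0 θ * f1 θ) ^ (((L : ℝ) - 1) / 4)) ∧
        Tendsto (fun L : ℕ => pPPT (probPar exProb L) (statePar exProb (exState θ) L))
          atTop (𝓝 (1 / 2)) ∧
        Tendsto (fun L : ℕ => pL (probPar exProb L) (statePar exProb (exState θ) L))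
          atTop (𝓝 (1 / 2)) ∧
        HidesOneBit exProb (exState θ))) ∧
    -- the condition holds at two particular angles
    (4 * f0 (Real.pi / 6) * f1 (Real.pi / 6) = (39 + √577) * (10 + √39) / 1024 ∧
      |4 * f0 (Real.pi / 6) * f1 (Real.pi / 6) - 0.9998| < 0.00005 ∧
      4 * f0 (Real.pi / 6) * f1 (Real.pi / 6) < 1) ∧
    (4 * f0 (Real.pi / 4) * f1 (Real.pi / 4) = (11 + √17) * (6 + √6) / 128 ∧
      |4 * f0 (Real.pi / 4) * f1 (Real.pi / 4) - 0.9983| < 0.00005 ∧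
      4 * f0 (Real.pi / 4) * f1 (Real.pi / 4) < 1) := by
  refine ⟨fun θ h0 h1 => ?_, ?_, ?_⟩
  · have hc : 0 ≤ Real.cos θ :=
      Real.cos_nonneg_of_neg_pi_div_two_le_of_le (by linarith [Real.pi_pos])
        (by linarith [Real.pi_pos])
    have hρ : ∀ i, IsState (exState θ i) := fun i => (isState_and_isSeparableState_exState θ i).1
    have hG : ∀ L : ℕ, ∃ M : ZMod 2 → _, IsMeasurement M ∧
        success (probPar exProb L) (statePar exProb (exState θ) L) M = 1 :=
      exists_perfect_measurement exProb (exState θ) exProb_nonneg sum_exProb (fun i => (hρ i).2)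
        (signObs_isHermitian θ) (signObs_mul_signObs θ) (trace_lam_mul_signObs θ)
    have hLO := half_le_pL exProb (exState θ) exProb_nonneg sum_exProb hρ
    have hLP := pL_le_pPPT exProb (exState θ) exProb_nonneg sum_exProb hρ
    refine ⟨isState_and_isSeparableState_exState θ, exState_mul_exState θ,
      partialTranspose_lam_exState θ, exH_isHermitian θ, exH_add_partialTranspose θ,
      traceNorm_exH θ, traceNorm_partialTranspose_exH θ hc, fun L _ =>
        ⟨pG_eq_one exProb (exState θ) exProb_nonneg sum_exProb hρ (hG L), hLO L, hLP L⟩,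
      fun hq1 => ?_⟩
    have hq0 : 0 < 4 * f0 θ * f1 θ :=
      mul_pos (mul_pos (by norm_num) (f0_pos θ)) (f1_pos θ hc)
    have hq : 4 * traceNorm (exH θ) * traceNorm (partialTranspose (exH θ)) = 4 * f0 θ * f1 θ := by
      rw [traceNorm_exH, traceNorm_partialTranspose_exH θ hc]
    have hb := pPPT_le exProb_nonneg sum_exProb hρ (partialTranspose_lam_exState θ)
      (exH_isHermitian θ) (exH_add_partialTranspose θ) hq hq0 hq1
    have hf := tendsto_half_add hq0 hq1
    refine ⟨fun L _ => hb L, ?_, ?_, ?_⟩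
    · exact tendsto_of_tendsto_of_tendsto_of_le_of_le tendsto_const_nhds hf
        (fun L => (hLO L).trans (hLP L)) hb
    · exact tendsto_of_tendsto_of_tendsto_of_le_of_le tendsto_const_nhds hf hLO
        fun L => (hLP L).trans (hb L)
    · exact hidesOneBit_of_bound exProb (exState θ) exProb_nonneg hG hf fun L M hM =>
        success_le_of_ppt exProb_nonneg sum_exProb hρ (partialTranspose_lam_exState θ)
          (exH_isHermitian θ) (exH_add_partialTranspose θ) hq hq0 hq1 hM
  · obtain ⟨h0, h1⟩ := value_pi_div_six_bounds
    rw [four_mul_f0_mul_f1_pi_div_six, abs_lt]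
    exact ⟨rfl, ⟨by linarith, by linarith⟩, by linarith⟩
  · obtain ⟨h0, h1⟩ := value_pi_div_four_bounds
    rw [four_mul_f0_mul_f1_pi_div_four, abs_lt]
    exact ⟨rfl, ⟨by linarith, by linarith⟩, by linarith⟩
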